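/- Consider instances given by integers $n,m\ge 1$, a matrix $A\in[0,1]^{m\times n}$ and $\varepsilon>0$, together with an unknown nonnegative monotone submodular function $f:2^{[n]}\to\mathbb{R}_{\ge 0}$, which is accessed through an oracle. Let $F(x)=\sum_{S\subseteq[n]} f(S)\prod_{i\in S}x_i\prod_{i\notin S}(1-x_i)$ be its multilinear extension and $F'$ the gradient of $F$. The multilinear relaxation is to maximize $F(x)$ over $x\in[0,1]^n$ subject to $Ax\le\mathbf 1$; let $\mathrm{OPT}$ be its optimal value. A $(1-1/e-\varepsilon)$-approximate feasible solution is an $x\in[0,1]^n$ with $Ax\le \mathbf 1$ and $F(x)\ge(1-1/e-\varepsilon)\,\mathrm{OPT}$. An adaptive algorithm works in rounds: in each round it submits a finite batch of oracle queries, which depends only on $n,m,A,\varepsilon$, on its coin flips, and on the answers received in earlier rounds. In the bounds below, $\log m$ is read as $\log\max(m,2)$. (i) There are a deterministic adaptive algorithm and absolute constants $C,K,k$ such that, on every instance, given an oracle that returns the value of $F$ or a single partial derivative of $F$ at a query point in $[0,1]^n$, the algorithm outputs a $(1-1/e-\varepsilon)$-approximate feasible solution after at most $C\,\frac{\log^2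 m\,\log n}{\varepsilon^4}$ adaptive rounds and at most $K\,n\left(\frac{\log n\,\log m}{\varepsilon}\right)^{k}$ oracle queries. In particular, if $m$ is polynomially bounded in $n$, the number of queries is $O(n\,\mathrm{poly}(\log n/\varepsilon))$. (ii) There is an absolute constant $C$ such that for every $c\in\mathbb{N}$ there are a randomized adaptive algorithm and constants $K,k$, depending only on $c$, such that, on every instance, given only a value oracle for $f$, the algorithm outputs a $(1-1/e-\varepsilon)$-approximate feasible solution with probability at least $1-n^{-c}$, and for every outcome of its coin flips it uses at most $C\,\frac{\log^2 m\,\log n}{\varepsilon^4}$ adaptive rounds and at most $K\,n^2\left(\frac{\log n\,\log m}{\varepsilon}\right)^{k}$ oracle queries. In particular, if $m$ is polynomially bounded in $n$, the number of queries is $O(n^2\,\mathrm{poly}(\log n/\varepsilon))$. -/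

import Mathlib

open scoped Matrix ENNReal

namespace PackingML

/-- Nonnegative, monotone, submodular set functions on the ground set `Fin n`. -/
structure IsMonotoneSubmodular {n : ℕ} (f : Finset (Fin n) → ℝ) : Prop where
  nonneg : ∀ S, 0 ≤ f S
  mono : ∀ S T, S ⊆ T → f S ≤ f T
  submodular : ∀ S T, f (S ∪ T) + f (S ∩ T) ≤ f S + f T

/-- The cube `[0,1]^n`. -/
def cube (n : ℕ) : Set (Fin n → ℝ) := {x | ∀ i, 0 ≤ x i ∧ x i ≤ 1}

/-- The multilinear extension `F` of `f`: the expected value of `f` on the random set that contains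
each `i` independently with probability `x i`. -/
noncomputable def multilinearExt {n : ℕ} (f : Finset (Fin n) → ℝ) (x : Fin n → ℝ) : ℝ :=
  ∑ S : Finset (Fin n), f S * ((∏ i ∈ S, x i) * ∏ i ∈ Sᶜ, (1 - x i))

/-- The partial derivative of `F` in coordinate `j`, at `x`. -/
noncomputable def multilinearGrad {n : ℕ} (f : Finset (Fin n) → ℝ) (j : Fin n)
    (x : Fin n → ℝ) : ℝ :=
  deriv (fun t => multilinearExt f (Function.update x j t)) (x j)

/-- The feasible region `{x ∈ [0,1]^n : A x ≤ 1}`. -/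
def feasible {m n : ℕ} (A : Matrix (Fin m) (Fin n) ℝ) : Set (Fin n → ℝ) :=
  {x | x ∈ cube n ∧ ∀ i, (A *ᵥ x) i ≤ 1}

/-- `x` is feasible for the multilinear relaxation and its value is at least `α` times the
optimum. -/
def IsApproxSolution {m n : ℕ} (A : Matrix (Fin m) (Fin n) ℝ) (f : Finset (Fin n) → ℝ) (α : ℝ)
    (x : Fin n → ℝ) : Prop :=
  x ∈ feasible A ∧ ∀ z ∈ feasible A, α * multilinearExt f z ≤ multilinearExt f x

/-- An adaptive algorithm with outputs in `X`, which interacts with an unknown real-valued oracle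
with queries in `Q`. At every point it stops with an output, or it flips a coin of its choice, or
it starts a new adaptive round: it submits a finite batch `B` of queries at once and
continues according to the answers. The batch of a round is thus a function of the coin
flips and of the answers in earlier rounds, and of nothing else. -/
inductive OracleAlg (Q X : Type) : Type 1
  | output (x : X) : OracleAlg Q X
  | coin (ι : Type) (p : PMF ι) (next : ι → OracleAlg Q X) : OracleAlg Q X
  | round (B : Finset Q) (next : ({q // q ∈ B} → ℝ) → OracleAlg Q X) : OracleAlg Q X

namespace OracleAlg

variable {Q X : Type}

/-- The algorithm never flips a coin. -/
def IsDeterministic : OracleAlg Q X → Prop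
  | output _ => True
  | coin _ _ _ => False
  | round _ next => ∀ a, (next a).IsDeterministic

/-- The law of the output when the oracle is `O`. -/
noncomputable def run (O : Q → ℝ) : OracleAlg Q X → PMF X
  | output x => PMF.pure x
  | coin _ p next => p.bind fun i => (next i).run O
  | round _ next => (next fun q => O q).run O

/-- The number of adaptive rounds with oracle `O`, in the worst case over the coin flips. -/
noncomputable def rounds (O : Q → ℝ) : OracleAlg Q X → ℕ∞
  | output _ => 0
  | coin _ _ next => ⨆ i, (next i).rounds O
  | round _ next => 1 + (next fun q => O q).rounds O

/-- The number of oracle queries with oracle `O`, in the worst case over the coin flips. -/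
noncomputable def queries (O : Q → ℝ) : OracleAlg Q X → ℕ∞
  | output _ => 0
  | coin _ _ next => ⨆ i, (next i).queries O
  | round B next => (B.card : ℕ∞) + (next fun q => O q).queries O

end OracleAlg

/-- Queries to `F` and to `F'`: the value of `F` at a point of the cube, or a single partial
derivative of `F` at a point of the cube. -/
inductive MLQuery (n : ℕ) : Type
  | value (x : cube n) : MLQuery n
  | grad (j : Fin n) (x : cube n) : MLQuery n

/-- The oracle for `F` and `F'`. -/
noncomputable def mlOracle {n : ℕ} (f : Finset (Fin n) → ℝ) : MLQuery n → ℝ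
  | .value x => multilinearExt f x
  | .grad j x => multilinearGrad f j x

/-- `log² m · log n / ε⁴`, where `m = 1` counts as `m = 2`. -/
noncomputable def roundBound (n m : ℕ) (ε : ℝ) : ℝ :=
  Real.log (max (m : ℝ) 2) ^ 2 * Real.log n / ε ^ 4

/-- The `k`-th power of `log n · log m / ε`, where `m = 1` counts as `m = 2`. -/
noncomputable def polylog (k n m : ℕ) (ε : ℝ) : ℝ :=
  (Real.log n * Real.log (max (m : ℝ) 2) / ε) ^ k

end PackingML

/-! Let `v` be the largest partial derivative of F at the origin, W = Σ_i exp(η(Ax)_i) the load, and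
V the gain F(z) - F(0) of a feasible point z to compare with. Up to the factor η, the price of a
coordinate is the derivative of W in it.

A run keeps a threshold T and raises, all at once, the coordinates whose derivative is at least T
times their price. Raising multiplies x_j + 1/n by 1 + δ, with x_j capped at 1, so after about log n
/ δ steps every coordinate has dropped out or equals 1. One that has dropped out stays out, because
derivatives fall and prices rise as x grows. Comparing x with x ∨ z then gives V - gain ≲ T W
(`gain_gap_le`), so T can be lowered by the factor 1 - a while T ≳ (V - gain) / W persists. Raised
coordinates therefore satisfy Δgain / (V - gain) ≳ ΔW / (ηW), and the missing gain decays like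
W^(-1/η) (`decay_of_growth`). The load starts at m, where log m ≤ aη, and x is frozen when log W is
near η, just before a constraint could break; by then a fraction of about 1/e is missing. A run that
never freezes ends with T so small that the gap itself is negligible (`Invariant.finish`).

Derivatives may drop a lot during one parallel step. The resulting loss is at most δ Σ (x_j + 1/n)
times the drop of the derivative, and this telescopes: it is absorbed into the potential `progress`,
which equals the gain up to lower order (`progress_sub_le`). No search for a step length is needed.

The starting threshold must match the unknown V. Since v ≤ V ≤ n v may be assumed, O(log n) powers
of two times v suffice as guesses; they run in parallel in the same rounds, and the best final value
is chosen.

The analysis uses derivatives only up to relative error a and additive error a v / n, and values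
only up to a(gain + v). So the algorithm is a `Dialogue`, analysed once under the assumption that
answers are good, and then compiled to either oracle. With a value oracle, a Chernoff bound shows
that about n · polylog samples per point are enough, and each costs 2n + 1 queries. With a = ε/20, η
= log m / a and δ = a² / log m there are O(log m / a²) phases of O(log n log m / a²) steps, which is
the round bound. -/

namespace PackingML

/-! ### The multilinear extension and its derivatives. -/

section MultilinearExtension

variable {n : ℕ}

/-- The probability that the random set with marginals `x` equals `S`. -/
noncomputable def setWeight (x : Fin n → ℝ) (S : Finset (Fin n)) : ℝ :=
  (∏ i ∈ S, x i) * ∏ i ∈ Sᶜ, (1 - x i)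

/-- The marginal value of `j` at `S`, where `j` itself does not count as an element of `S`. -/
def marginal (f : Finset (Fin n) → ℝ) (j : Fin n) (S : Finset (Fin n)) : ℝ :=
  f (insert j S) - f (S.erase j)

theorem multilinearExt_eq (f : Finset (Fin n) → ℝ) (x : Fin n → ℝ) :
    multilinearExt f x = ∑ S, setWeight x S * f S :=
  Finset.sum_congr rfl fun _ _ => mul_comm _ _

theorem setWeight_nonneg {x : Fin n → ℝ} (hx : x ∈ cube n) (S : Finset (Fin n)) :
    0 ≤ setWeight x S :=
  mul_nonneg (Finset.prod_nonneg fun i _ => (hx i).1)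
    (Finset.prod_nonneg fun i _ => sub_nonneg.2 (hx i).2)

theorem sum_setWeight (x : Fin n → ℝ) : ∑ S, setWeight x S = 1 := by
  have h := Finset.prod_add x (fun i => 1 - x i) Finset.univ
  simp only [add_sub_cancel, Finset.prod_const_one, Finset.powerset_univ] at h
  rw [h]
  exact Finset.sum_congr rfl fun S _ => by rw [setWeight, Finset.compl_eq_univ_sdiff]

theorem sum_split (j : Fin n) (h : Finset (Fin n) → ℝ) :
    ∑ S, h S = ∑ S ∈ (Finset.univ.erase j).powerset, (h S + h (insert j S)) := by
  have := Finset.sum_powerset_insert (Finset.notMem_erase j Finset.univ) h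
  rw [Finset.insert_erase (Finset.mem_univ j), Finset.powerset_univ] at this
  rw [this, Finset.sum_add_distrib]

/-- The probability that the random set agrees with `S` outside `j`. -/
noncomputable def restWeight (j : Fin n) (x : Fin n → ℝ) (S : Finset (Fin n)) : ℝ :=
  (∏ i ∈ S, x i) * ∏ i ∈ (insert j S)ᶜ, (1 - x i)

theorem multilinearExt_split (f : Finset (Fin n) → ℝ) (j : Fin n) (x : Fin n → ℝ) :
    multilinearExt f x = ∑ S ∈ (Finset.univ.erase j).powerset,
      restWeight j x S * ((1 - x j) * f S + x j * f (insert j S)) := by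
  rw [multilinearExt_eq, sum_split j]
  refine Finset.sum_congr rfl fun S hS => ?_
  have hj : j ∉ S := fun h => Finset.notMem_erase j _ (Finset.mem_powerset.1 hS h)
  have h1 : Sᶜ = insert j (insert j S)ᶜ := by
    ext i; by_cases h : i = j <;> simp [h, hj]
  rw [setWeight, setWeight, restWeight, Finset.prod_insert hj, h1, Finset.prod_insert (by simp)]
  ring

theorem restWeight_update (j : Fin n) (x : Fin n → ℝ) (t : ℝ) {S : Finset (Fin n)}
    (hj : j ∉ S) : restWeight j (Function.update x j t) S = restWeight j x S := by
  unfold restWeight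
  congr 1
  · exact Finset.prod_congr rfl fun i hi =>
      Function.update_of_ne (ne_of_mem_of_not_mem hi hj) _ _
  · refine Finset.prod_congr rfl fun i hi => ?_
    rw [Function.update_of_ne]
    rintro rfl
    simp at hi

/-- Conditioning on the random set outside `j` shows that F is affine in coordinate `j`. As
`marginal f j` ignores whether `j` lies in the set, its extension is the slope. -/
theorem multilinearExt_update (f : Finset (Fin n) → ℝ) (j : Fin n) (x : Fin n → ℝ) (t : ℝ) :
    multilinearExt f (Function.update x j t) =
      multilinearExt f x + (t - x j) * multilinearExt (marginal f j) x := by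
  rw [multilinearExt_split f j, multilinearExt_split f j, multilinearExt_split _ j,
    Finset.mul_sum, ← Finset.sum_add_distrib]
  refine Finset.sum_congr rfl fun S hS => ?_
  have hj : j ∉ S := fun h => Finset.notMem_erase j _ (Finset.mem_powerset.1 hS h)
  simp only [restWeight_update j x t hj, Function.update_self, marginal,
    Finset.erase_eq_of_notMem hj, Finset.insert_idem, Finset.erase_insert hj]
  ring

theorem multilinearGrad_eq (f : Finset (Fin n) → ℝ) (j : Fin n) (x : Fin n → ℝ) :
    multilinearGrad f j x = multilinearExt (marginal f j) x := by
  unfold multilinearGrad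
  simp only [multilinearExt_update]
  have h : HasDerivAt (fun t : ℝ => multilinearExt f x +
      (t - x j) * multilinearExt (marginal f j) x) (1 * multilinearExt (marginal f j) x) (x j) :=
    (((hasDerivAt_id (x j)).sub_const (x j)).mul_const _).const_add _
  simp [h.deriv]

theorem multilinearExt_nonneg {f : Finset (Fin n) → ℝ} (hf : ∀ S, 0 ≤ f S) {x : Fin n → ℝ}
    (hx : x ∈ cube n) : 0 ≤ multilinearExt f x := by
  rw [multilinearExt_eq]
  exact Finset.sum_nonneg fun S _ => mul_nonneg (setWeight_nonneg hx S) (hf S)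

theorem multilinearExt_zero (f : Finset (Fin n) → ℝ) : multilinearExt f 0 = f ∅ := by
  rw [multilinearExt_eq, Finset.sum_eq_single ∅]
  · simp [setWeight]
  · intro S _ hS
    obtain ⟨i, hi⟩ := Finset.nonempty_iff_ne_empty.2 hS
    simp [setWeight, Finset.prod_eq_zero hi]
  · simp

theorem zero_mem_cube : (0 : Fin n → ℝ) ∈ cube n := fun _ => by simp

theorem piecewise_mem_cube {x y : Fin n → ℝ} (hx : x ∈ cube n) (hy : y ∈ cube n)
    (s : Finset (Fin n)) : s.piecewise y x ∈ cube n := fun i => by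
  by_cases h : i ∈ s <;> simp [h, hx i, hy i]

/-- Moving from `x` to `y` one coordinate at a time. -/
theorem multilinearExt_piecewise_insert (f : Finset (Fin n) → ℝ) (x y : Fin n → ℝ)
    {j : Fin n} {s : Finset (Fin n)} (hj : j ∉ s) :
    multilinearExt f ((insert j s).piecewise y x) = multilinearExt f (s.piecewise y x) +
      (y j - x j) * multilinearExt (marginal f j) (s.piecewise y x) := by
  rw [Finset.piecewise_insert, multilinearExt_update]
  simp [hj]

theorem multilinearExt_mono {f : Finset (Fin n) → ℝ} (hf : ∀ S T, S ⊆ T → f S ≤ f T)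
    {x y : Fin n → ℝ} (hx : x ∈ cube n) (hy : y ∈ cube n) (hxy : ∀ i, x i ≤ y i) :
    multilinearExt f x ≤ multilinearExt f y := by
  have key : ∀ s : Finset (Fin n), multilinearExt f x ≤ multilinearExt f (s.piecewise y x) := by
    intro s
    induction s using Finset.induction_on with
    | empty => simp
    | insert j s hj ih =>
      rw [multilinearExt_piecewise_insert f x y hj]
      have h1 := multilinearExt_nonneg (f := marginal f j) (fun S => sub_nonneg.2
        (hf _ _ ((Finset.erase_subset _ _).trans (Finset.subset_insert _ _))))
        (piecewise_mem_cube hx hy s)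
      have := mul_nonneg (sub_nonneg.2 (hxy j)) h1
      linarith
  simpa using key Finset.univ

theorem multilinearExt_neg (f : Finset (Fin n) → ℝ) (x : Fin n → ℝ) :
    multilinearExt (fun S => -f S) x = -multilinearExt f x := by
  simp [multilinearExt_eq]

theorem multilinearExt_anti {f : Finset (Fin n) → ℝ} (hf : ∀ S T, S ⊆ T → f T ≤ f S)
    {x y : Fin n → ℝ} (hx : x ∈ cube n) (hy : y ∈ cube n) (hxy : ∀ i, x i ≤ y i) :
    multilinearExt f y ≤ multilinearExt f x := by
  have := multilinearExt_mono (f := fun S => -f S) (fun S T h => neg_le_neg (hf S T h)) hx hy hxy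
  simp only [multilinearExt_neg] at this
  linarith

namespace IsMonotoneSubmodular

variable {f : Finset (Fin n) → ℝ}

theorem marginal_nonneg (hf : IsMonotoneSubmodular f) (j : Fin n) (S : Finset (Fin n)) :
    0 ≤ marginal f j S :=
  sub_nonneg.2 (hf.mono _ _ ((Finset.erase_subset _ _).trans (Finset.subset_insert _ _)))

/-- Submodularity for `insert j S` and `T.erase j`, whose union and intersection are `insert j T`
and `S.erase j`. -/
theorem marginal_anti (hf : IsMonotoneSubmodular f) (j : Fin n) (S T : Finset (Fin n)) (h : S ⊆ T) :
    marginal f j T ≤ marginal f j S := by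
  have h1 := hf.submodular (insert j S) (T.erase j)
  have h2 : insert j S ∪ T.erase j = insert j T := by
    ext i; have := @h i; by_cases i = j <;> simp_all
  have h3 : insert j S ∩ T.erase j = S.erase j := by
    ext i; have := @h i; by_cases i = j <;> simp_all
  rw [h2, h3] at h1
  unfold marginal
  linarith

theorem grad_nonneg (hf : IsMonotoneSubmodular f) (j : Fin n) {x : Fin n → ℝ} (hx : x ∈ cube n) :
    0 ≤ multilinearExt (marginal f j) x :=
  multilinearExt_nonneg (hf.marginal_nonneg j) hx

theorem grad_anti (hf : IsMonotoneSubmodular f) (j : Fin n) {x y : Fin n → ℝ}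
    (hx : x ∈ cube n) (hy : y ∈ cube n)
    (hxy : ∀ i, x i ≤ y i) :
    multilinearExt (marginal f j) y ≤ multilinearExt (marginal f j) x :=
  multilinearExt_anti (hf.marginal_anti j) hx hy hxy

/-- Raising one coordinate at a time changes F by the step length times a derivative at a point
between `x` and `y`, and derivatives are antitone. This is concavity along nonnegative directions.
-/
theorem sub_le_and_le_sub (hf : IsMonotoneSubmodular f) {x y : Fin n → ℝ}
    (hx : x ∈ cube n) (hy : y ∈ cube n)
    (hxy : ∀ i, x i ≤ y i) :
    ∑ j, (y j - x j) * multilinearExt (marginal f j) y ≤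
        multilinearExt f y - multilinearExt f x ∧
      multilinearExt f y - multilinearExt f x ≤
        ∑ j, (y j - x j) * multilinearExt (marginal f j) x := by
  have key : ∀ s : Finset (Fin n),
      ∑ j ∈ s, (y j - x j) * multilinearExt (marginal f j) y ≤
          multilinearExt f (s.piecewise y x) - multilinearExt f x ∧
        multilinearExt f (s.piecewise y x) - multilinearExt f x ≤
          ∑ j ∈ s, (y j - x j) * multilinearExt (marginal f j) x := by
    intro s
    induction s using Finset.induction_on with
    | empty => simp
    | insert j s hj ih =>
      rw [multilinearExt_piecewise_insert f x y hj, Finset.sum_insert hj, Finset.sum_insert hj]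
      have hp := piecewise_mem_cube hx hy s
      have h1 := mul_le_mul_of_nonneg_left (hf.grad_anti j hp hy fun i => by
        by_cases h : i ∈ s <;> simp [h, hxy i]) (sub_nonneg.2 (hxy j))
      have h2 := mul_le_mul_of_nonneg_left (hf.grad_anti j hx hp fun i => by
        by_cases h : i ∈ s <;> simp [h, hxy i]) (sub_nonneg.2 (hxy j))
      constructor <;> linarith [ih.1, ih.2]
  simpa using key Finset.univ

end IsMonotoneSubmodular

end MultilinearExtension

/-! ### Parameters, constraint weights and the potential. -/

/-- The parameters of one run: accuracy `a`, smoothing `η` of the maximum of the `m` constraints,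
and relative step size `δ`. -/
structure StepParams (m : ℕ) where
  a : ℝ
  η : ℝ
  δ : ℝ
  a_pos : 0 < a
  a_le : a ≤ 1 / 20
  η_pos : 0 < η
  δ_pos : 0 < δ
  η_mul_δ : η * δ = a
  δ_le : δ ≤ a
  log_le : Real.log m ≤ a * η

/-- The total weight of the constraints at `x`. -/
noncomputable def load {m n : ℕ} (A : Matrix (Fin m) (Fin n) ℝ) (η : ℝ) (x : Fin n → ℝ) : ℝ :=
  ∑ i, Real.exp (η * (A *ᵥ x) i)

/-- The weighted cost of coordinate `j` at `x`. -/
noncomputable def price {m n : ℕ} (A : Matrix (Fin m) (Fin n) ℝ) (η : ℝ) (x : Fin n → ℝ)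
    (j : Fin n) : ℝ :=
  ∑ i, Real.exp (η * (A *ᵥ x) i) * A i j

/-- The value of `F` above its value at the origin. -/
noncomputable def gain {n : ℕ} (f : Finset (Fin n) → ℝ) (x : Fin n → ℝ) : ℝ :=
  multilinearExt f x - multilinearExt f 0

/-- The potential function that measures progress: up to lower order terms it is the gain. -/
noncomputable def progress {n : ℕ} (f : Finset (Fin n) → ℝ) (a δ v : ℝ) (x : Fin n → ℝ) : ℝ :=
  (1 + δ) * gain f x - δ * ∑ j, (x j + 1 / n) * multilinearExt (marginal f j) x +
    a * (v / n) * ∑ j, x j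

/-! ### The potential: growth in a step and comparison with the gain. -/

section Progress

variable {n : ℕ} {f : Finset (Fin n) → ℝ}

theorem gain_nonneg (hf : IsMonotoneSubmodular f) {x : Fin n → ℝ} (hx : x ∈ cube n) :
    0 ≤ gain f x :=
  sub_nonneg.2 (multilinearExt_mono hf.mono zero_mem_cube hx fun i => (hx i).1)

theorem grad_le (hf : IsMonotoneSubmodular f) {v : ℝ}
    (hv : ∀ j, multilinearExt (marginal f j) 0 ≤ v) {x : Fin n → ℝ} (hx : x ∈ cube n)
    (j : Fin n) : multilinearExt (marginal f j) x ≤ v :=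
  (hf.grad_anti j zero_mem_cube hx fun i => (hx i).1).trans (hv j)

theorem gain_le (hf : IsMonotoneSubmodular f) {v : ℝ}
    (hv : ∀ j, multilinearExt (marginal f j) 0 ≤ v) {x : Fin n → ℝ} (hx : x ∈ cube n) :
    gain f x ≤ n * v := by
  refine (hf.sub_le_and_le_sub zero_mem_cube hx fun i => (hx i).1).2.trans ?_
  refine (Finset.sum_le_sum (g := fun _ => v) fun j _ => ?_).trans (by simp)
  have h0 := hf.grad_nonneg j (zero_mem_cube (n := n))
  have := hv j
  have := hx j
  simp only [Pi.zero_apply, sub_zero]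
  nlinarith

/-- F grows at least by the step times the gradient at the end point `y`. What is lost against the
gradient at `x` is at most δ Σ (x_j + 1/n) times the drop of the derivatives, and the correction
term of `progress` pays for it. -/
theorem progress_sub_le (hf : IsMonotoneSubmodular f) {a δ v : ℝ} (hδ : 0 ≤ δ)
    {x y : Fin n → ℝ} (hx : x ∈ cube n) (hy : y ∈ cube n) (hxy : ∀ j, x j ≤ y j)
    (hstep : ∀ j, y j - x j ≤ δ * (x j + 1 / n)) :
    ∑ j, (y j - x j) * (multilinearExt (marginal f j) x + a * (v / n)) ≤
      progress f a δ v y - progress f a δ v x := by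
  have h1 := (hf.sub_le_and_le_sub hx hy hxy).1
  have h2 : ∑ j, (y j - x j) *
        (multilinearExt (marginal f j) x - multilinearExt (marginal f j) y) ≤
      ∑ j, δ * (x j + 1 / n) *
        (multilinearExt (marginal f j) x - multilinearExt (marginal f j) y) :=
    Finset.sum_le_sum fun j _ => mul_le_mul_of_nonneg_right (hstep j)
      (sub_nonneg.2 (hf.grad_anti j hx hy hxy))
  have h3 := mul_le_mul_of_nonneg_left h1 hδ
  have e1 : ∑ j, (y j - x j) * (multilinearExt (marginal f j) x + a * (v / n)) =
      ∑ j, (y j - x j) * (multilinearExt (marginal f j) x - multilinearExt (marginal f j) y) +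
      ∑ j, (y j - x j) * multilinearExt (marginal f j) y +
      (a * (v / n) * ∑ j, y j - a * (v / n) * ∑ j, x j) := by
    simp only [Finset.mul_sum, ← Finset.sum_add_distrib, ← Finset.sum_sub_distrib]
    exact Finset.sum_congr rfl fun j _ => by ring
  have e2 : ∑ j, δ * (x j + 1 / n) *
        (multilinearExt (marginal f j) x - multilinearExt (marginal f j) y) =
      δ * (∑ j, (x j + 1 / n) * multilinearExt (marginal f j) x) -
      δ * (∑ j, (y j + 1 / n) * multilinearExt (marginal f j) y) +
      δ * ∑ j, (y j - x j) * multilinearExt (marginal f j) y := by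
    simp only [Finset.mul_sum, ← Finset.sum_add_distrib, ← Finset.sum_sub_distrib]
    exact Finset.sum_congr rfl fun j _ => by ring
  unfold progress gain
  rw [e1]
  rw [e2] at h2
  linarith

/-- Keeps the correction term in `progress` of lower order: the part with x_j is at most the gain by
concavity from the origin, the part with 1/n is an average of derivatives. -/
theorem sum_grad_le (hf : IsMonotoneSubmodular f) {v : ℝ} (hn : 0 < n)
    (hv : ∀ j, multilinearExt (marginal f j) 0 ≤ v) {x : Fin n → ℝ} (hx : x ∈ cube n) :
    ∑ j, (x j + 1 / n) * multilinearExt (marginal f j) x ≤ gain f x + v := by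
  have h1 := (hf.sub_le_and_le_sub zero_mem_cube hx fun i => (hx i).1).1
  have h2 : ∑ j, 1 / (n : ℝ) * multilinearExt (marginal f j) x ≤ v := by
    refine (Finset.sum_le_sum (g := fun _ => 1 / (n : ℝ) * v) fun j _ =>
      mul_le_mul_of_nonneg_left (grad_le hf hv hx j) (by positivity)).trans ?_
    have : (n : ℝ) ≠ 0 := by positivity
    simp [this]
  simp only [Pi.zero_apply, sub_zero] at h1
  simp only [add_mul, Finset.sum_add_distrib]
  unfold gain
  linarith

theorem gain_le_progress (hf : IsMonotoneSubmodular f) {a δ v : ℝ} (hn : 0 < n) (ha : 0 ≤ a)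
    (hδ : 0 ≤ δ) (hv0 : 0 ≤ v) (hv : ∀ j, multilinearExt (marginal f j) 0 ≤ v)
    {x : Fin n → ℝ} (hx : x ∈ cube n) :
    gain f x ≤ progress f a δ v x + δ * v := by
  have h1 := mul_le_mul_of_nonneg_left (sum_grad_le hf hn hv hx) hδ
  have h2 : 0 ≤ a * (v / n) * ∑ j, x j :=
    mul_nonneg (by positivity) (Finset.sum_nonneg fun j _ => (hx j).1)
  unfold progress
  linarith

theorem progress_le (hf : IsMonotoneSubmodular f) {a δ v : ℝ} (hn : 0 < n) (ha : 0 ≤ a)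
    (hδ : 0 ≤ δ) (hv0 : 0 ≤ v) {x : Fin n → ℝ} (hx : x ∈ cube n) :
    progress f a δ v x ≤ (1 + δ) * gain f x + a * v := by
  have h1 : 0 ≤ ∑ j, (x j + 1 / n) * multilinearExt (marginal f j) x :=
    Finset.sum_nonneg fun j _ => mul_nonneg (add_nonneg (hx j).1 (by positivity))
      (hf.grad_nonneg j hx)
  have h2 : ∑ j, x j ≤ n :=
    (Finset.sum_le_sum (g := fun _ => 1) fun j _ => (hx j).2).trans (by simp)
  have h3 := mul_le_mul_of_nonneg_left h2 (show 0 ≤ a * (v / n) by positivity)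
  have h4 : a * (v / n) * n = a * v := by field_simp
  have := mul_nonneg hδ h1
  unfold progress
  linarith

theorem neg_le_progress_zero (hf : IsMonotoneSubmodular f) {a δ v : ℝ} (hn : 0 < n)
    (hδ : 0 ≤ δ) (hv : ∀ j, multilinearExt (marginal f j) 0 ≤ v) :
    -(δ * v) ≤ progress f a δ v 0 := by
  have h1 := mul_le_mul_of_nonneg_left (sum_grad_le hf hn hv zero_mem_cube) hδ
  have h2 : gain f 0 = 0 := sub_self _
  rw [h2] at h1
  unfold progress
  rw [h2]
  simp only [Pi.zero_apply, Finset.sum_const_zero] at h1 ⊢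
  linarith

end Progress

/-! ### The exponential weights of the constraints. -/

section Load

variable {m n : ℕ} {A : Matrix (Fin m) (Fin n) ℝ} {η : ℝ}

theorem mulVec_mono (hA : ∀ i j, 0 ≤ A i j) {x y : Fin n → ℝ} (hxy : ∀ j, x j ≤ y j)
    (i : Fin m) : (A *ᵥ x) i ≤ (A *ᵥ y) i := by
  simp only [Matrix.mulVec, dotProduct]
  exact Finset.sum_le_sum fun j _ => mul_le_mul_of_nonneg_left (hxy j) (hA i j)

theorem load_mono (hA : ∀ i j, 0 ≤ A i j) (hη : 0 ≤ η) {x y : Fin n → ℝ}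
    (hxy : ∀ j, x j ≤ y j) : load A η x ≤ load A η y :=
  Finset.sum_le_sum fun i _ => Real.exp_le_exp.2
    (mul_le_mul_of_nonneg_left (mulVec_mono hA hxy i) hη)

theorem price_mono (hA : ∀ i j, 0 ≤ A i j) (hη : 0 ≤ η) {x y : Fin n → ℝ}
    (hxy : ∀ j, x j ≤ y j) (j : Fin n) : price A η x j ≤ price A η y j :=
  Finset.sum_le_sum fun i _ => mul_le_mul_of_nonneg_right (Real.exp_le_exp.2
    (mul_le_mul_of_nonneg_left (mulVec_mono hA hxy i) hη)) (hA i j)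

theorem price_nonneg (hA : ∀ i j, 0 ≤ A i j) (x : Fin n → ℝ) (j : Fin n) :
    0 ≤ price A η x j :=
  Finset.sum_nonneg fun i _ => mul_nonneg (Real.exp_pos _).le (hA i j)

theorem sum_mul_price (A : Matrix (Fin m) (Fin n) ℝ) (η : ℝ) (x z : Fin n → ℝ) :
    ∑ j, z j * price A η x j = ∑ i, Real.exp (η * (A *ᵥ x) i) * (A *ᵥ z) i := by
  simp only [price, Matrix.mulVec, dotProduct, Finset.mul_sum]
  rw [Finset.sum_comm]
  exact Finset.sum_congr rfl fun i _ => Finset.sum_congr rfl fun j _ => by ring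

theorem sum_mul_price_le {z : Fin n → ℝ} (hz : ∀ i, (A *ᵥ z) i ≤ 1) (x : Fin n → ℝ) :
    ∑ j, z j * price A η x j ≤ load A η x := by
  rw [sum_mul_price]
  exact Finset.sum_le_sum fun i _ => mul_le_of_le_one_right (Real.exp_pos _).le (hz i)

theorem exp_le_load (x : Fin n → ℝ) (i : Fin m) : Real.exp (η * (A *ᵥ x) i) ≤ load A η x :=
  Finset.single_le_sum (f := fun i => Real.exp (η * (A *ᵥ x) i))
    (fun _ _ => (Real.exp_pos _).le) (Finset.mem_univ i)

theorem load_zero : load A η 0 = m := by simp [load]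

theorem load_ge (hA : ∀ i j, 0 ≤ A i j) (hη : 0 ≤ η) {x : Fin n → ℝ} (hx : ∀ j, 0 ≤ x j) :
    (m : ℝ) ≤ load A η x := by
  rw [← load_zero (A := A) (η := η)]
  exact load_mono hA hη hx

/-- For 0 ≤ u ≤ b ≤ 1 one has exp u - 1 ≤ u + u² ≤ (1 + b) u, so steps with small change of the
exponents are nearly linear. -/
theorem load_sub_le (hη : 0 ≤ η) {b : ℝ} (hb : b ≤ 1) {x y : Fin n → ℝ}
    (h0 : ∀ i, (A *ᵥ x) i ≤ (A *ᵥ y) i) (h1 : ∀ i, η * ((A *ᵥ y) i - (A *ᵥ x) i) ≤ b) :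
    load A η y - load A η x ≤ η * (1 + b) * ∑ j, (y j - x j) * price A η x j := by
  have e := sum_mul_price A η x (y - x)
  simp only [Pi.sub_apply, Matrix.mulVec_sub] at e
  rw [e, load, load, ← Finset.sum_sub_distrib, Finset.mul_sum]
  refine Finset.sum_le_sum fun i _ => ?_
  set u := η * ((A *ᵥ y) i - (A *ᵥ x) i) with hu
  have hu0 : 0 ≤ u := mul_nonneg hη (sub_nonneg.2 (h0 i))
  have h2 := (abs_le.1 (Real.abs_exp_sub_one_sub_id_le
    (abs_le.2 ⟨by linarith, (h1 i).trans hb⟩ : |u| ≤ 1))).2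
  have h3 : Real.exp (η * (A *ᵥ y) i) = Real.exp (η * (A *ᵥ x) i) * Real.exp u := by
    rw [← Real.exp_add, hu]; ring_nf
  have h4 : Real.exp u - 1 ≤ (1 + b) * u := by nlinarith [h1 i]
  rw [h3]
  calc _ = Real.exp (η * (A *ᵥ x) i) * (Real.exp u - 1) := by ring
    _ ≤ Real.exp (η * (A *ᵥ x) i) * ((1 + b) * u) :=
        mul_le_mul_of_nonneg_left h4 (Real.exp_pos _).le
    _ = _ := by rw [hu]; ring

end Load

/-- When no coordinate is worth its price any more, the gain is close to the optimum, relative to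
the threshold `T`. -/
theorem gain_gap_le {m n : ℕ} {A : Matrix (Fin m) (Fin n) ℝ} {η : ℝ}
    {f : Finset (Fin n) → ℝ} (hf : IsMonotoneSubmodular f) (hA : ∀ i j, 0 ≤ A i j)
    {a v T : ℝ} (ha : 0 ≤ a) (ha1 : a ≤ 1) (hv0 : 0 ≤ v) (hT : 0 ≤ T)
    {x z : Fin n → ℝ} (hx : x ∈ cube n) (hz : z ∈ feasible A)
    (hbad : ∀ j, x j = 1 ∨
      (1 - a) * multilinearExt (marginal f j) x ≤ T * price A η x j + a * (v / n)) :
    (1 - a) * (gain f z - gain f x) ≤ T * load A η x + a * v := by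
  -- The join x ∨ z lies above both points and exceeds `x` by at most `z` in each coordinate, so the
  -- constraints on `z` bound the cost of moving there. Coordinates already at 1 do not move.
  set y : Fin n → ℝ := fun j => max (x j) (z j) with hy
  have hyc : y ∈ cube n := fun j =>
    ⟨(hx j).1.trans (le_max_left _ _), max_le (hx j).2 (hz.1 j).2⟩
  have h1 : gain f z ≤ gain f y := sub_le_sub_right
    (multilinearExt_mono hf.mono hz.1 hyc fun j => le_max_right _ _) _
  have h2 := (hf.sub_le_and_le_sub hx hyc fun j => le_max_left _ _).2
  have h3 : (1 - a) * ∑ j, (y j - x j) * multilinearExt (marginal f j) x ≤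
      ∑ j, (T * (z j * price A η x j) + a * (v / n)) := by
    rw [Finset.mul_sum]
    refine Finset.sum_le_sum fun j _ => ?_
    have hp := price_nonneg (η := η) hA x j
    have hvn : 0 ≤ a * (v / n) := by positivity
    have hz0 := (hz.1 j).1
    have hz1 := (hz.1 j).2
    have hx0 := (hx j).1
    have hpos : 0 ≤ T * (z j * price A η x j) := by positivity
    have hd0 : 0 ≤ y j - x j := sub_nonneg.2 (le_max_left _ _)
    rcases hbad j with h | h
    · have : y j - x j = 0 := by simp [hy, h, hz1]
      rw [this]; linarith
    · have hdz : y j - x j ≤ z j := by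
        rw [hy]; simp only [tsub_le_iff_right]; exact max_le (by linarith) (by linarith)
      calc _ = (y j - x j) * ((1 - a) * multilinearExt (marginal f j) x) := by ring
        _ ≤ (y j - x j) * (T * price A η x j + a * (v / n)) :=
            mul_le_mul_of_nonneg_left h hd0
        _ = (y j - x j) * (T * price A η x j) + (y j - x j) * (a * (v / n)) := by ring
        _ ≤ z j * (T * price A η x j) + 1 * (a * (v / n)) := by
            gcongr
            linarith
        _ = _ := by ring
  rw [Finset.sum_add_distrib, ← Finset.mul_sum] at h3
  have h4 := mul_le_mul_of_nonneg_left (sum_mul_price_le (η := η) hz.2 x) hT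
  have h5 : ∑ _j : Fin n, a * (v / n) ≤ a * v := by
    rcases Nat.eq_zero_or_pos n with rfl | hn
    · simpa using mul_nonneg ha hv0
    · have : (n : ℝ) ≠ 0 := by positivity
      simp only [Finset.sum_const, Finset.card_univ, Fintype.card_fin, nsmul_eq_mul]
      field_simp
      rfl
  have h6 : gain f z - gain f x ≤ multilinearExt f y - multilinearExt f x := by
    unfold gain at *; linarith
  have h7 := mul_le_mul_of_nonneg_left (h6.trans h2) (sub_nonneg.2 ha1)
  linarith

/-! ### Raising a set of coordinates. -/

section Increment

variable {n : ℕ} {δ : ℝ} {x : Fin n → ℝ} {S : Finset (Fin n)}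

/-- Increase the coordinates in `S` by a factor `1 + δ`, up to an additive term. -/
noncomputable def increment (δ : ℝ) (x : Fin n → ℝ) (S : Finset (Fin n)) : Fin n → ℝ :=
  fun j => if j ∈ S then min 1 (x j + δ * (x j + 1 / n)) else x j

theorem increment_of_notMem {j : Fin n} (hj : j ∉ S) : increment δ x S j = x j := if_neg hj

theorem step_size_nonneg (hδ : 0 ≤ δ) (hx : x ∈ cube n) (j : Fin n) :
    0 ≤ δ * (x j + 1 / n) :=
  mul_nonneg hδ (add_nonneg (hx j).1 (by positivity))

theorem le_increment (hδ : 0 ≤ δ) (hx : x ∈ cube n) (j : Fin n) : x j ≤ increment δ x S j := by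
  have := step_size_nonneg hδ hx j
  unfold increment
  split_ifs
  · exact le_min (hx j).2 (by linarith)
  · exact le_rfl

theorem increment_sub_le (hδ : 0 ≤ δ) (hx : x ∈ cube n) (j : Fin n) :
    increment δ x S j - x j ≤ δ * (x j + 1 / n) := by
  have := step_size_nonneg hδ hx j
  unfold increment
  split_ifs
  · linarith [min_le_right 1 (x j + δ * (x j + 1 / n))]
  · simpa using this

theorem increment_mem_cube (hδ : 0 ≤ δ) (hx : x ∈ cube n) : increment δ x S ∈ cube n := by
  refine fun j => ⟨(hx j).1.trans (le_increment hδ hx j), ?_⟩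
  unfold increment
  split_ifs
  · exact min_le_left _ _
  · exact (hx j).2

/-- The relative part of the step adds at most δ (Ax)_i ≤ δ, and the additive parts δ/n sum to at
most δ because the entries of A are at most 1. -/
theorem mulVec_increment_le {m : ℕ} {A : Matrix (Fin m) (Fin n) ℝ}
    (hA : ∀ i j, 0 ≤ A i j ∧ A i j ≤ 1) (hδ : 0 ≤ δ) (hx : x ∈ cube n) {i : Fin m}
    (hi : (A *ᵥ x) i ≤ 1) : (A *ᵥ increment δ x S) i - (A *ᵥ x) i ≤ 2 * δ := by
  have h1 : (A *ᵥ increment δ x S) i - (A *ᵥ x) i ≤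
      ∑ j, (δ * (A i j * x j) + δ * (1 / n)) := by
    simp only [Matrix.mulVec, dotProduct, ← Finset.sum_sub_distrib]
    refine Finset.sum_le_sum fun j _ => ?_
    have h2 := mul_le_mul_of_nonneg_left (increment_sub_le (S := S) hδ hx j) (hA i j).1
    have h3 : 0 ≤ δ * (1 / (n : ℝ)) := by positivity
    have h4 := mul_le_mul_of_nonneg_right (hA i j).2 h3
    linarith
  rw [Finset.sum_add_distrib, ← Finset.mul_sum] at h1
  have h5 : ∑ _j : Fin n, δ * (1 / (n : ℝ)) ≤ δ := by
    rcases Nat.eq_zero_or_pos n with rfl | hn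
    · simpa using hδ
    · have : (n : ℝ) ≠ 0 := by positivity
      simp only [Finset.sum_const, Finset.card_univ, Fintype.card_fin, nsmul_eq_mul]
      field_simp
      rfl
  have h6 := mul_le_mul_of_nonneg_left (show ∑ j, A i j * x j ≤ 1 from hi) hδ
  linarith

end Increment

/-- If the progress grows in proportion to the missing progress and to the relative growth of the
load, then the missing progress decays like a power of the load. -/
theorem decay_of_growth {V κ η l W W' H H' c : ℝ} (hV : 0 ≤ V) (hκ : 0 ≤ κ) (hη : 0 < η)
    (hW : 0 < W) (hWW : W ≤ W') (hHH : H ≤ H')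
    (hgrow : 0 ≤ c - H → κ * (c - H) * (W' - W) ≤ η * W * (H' - H))
    (hinv : c - H ≤ V * Real.exp (-κ * (Real.log W - l) / η)) :
    c - H' ≤ V * Real.exp (-κ * (Real.log W' - l) / η) := by
  rcases lt_or_ge (c - H) 0 with h | h
  · have := mul_nonneg hV (Real.exp_pos (-κ * (Real.log W' - l) / η)).le
    linarith
  have hg := hgrow h
  -- The relative growth of the load is at least the growth of its logarithm. The decay then follows
  -- from 1 - u ≤ exp(-u) with u = κw/η.
  set w := Real.log W' - Real.log W with hw
  have hw1 : w ≤ (W' - W) / W := by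
    have := Real.log_le_sub_one_of_pos (div_pos (hW.trans_le hWW) hW)
    rw [Real.log_div (hW.trans_le hWW).ne' hW.ne'] at this
    rw [sub_div, div_self hW.ne']
    exact this
  have h1 : κ / η * w * (c - H) ≤ H' - H := by
    have : κ / η * ((W' - W) / W) * (c - H) ≤ H' - H := by
      rw [show κ / η * ((W' - W) / W) * (c - H) = κ * (c - H) * (W' - W) / (η * W) by
        field_simp, div_le_iff₀ (by positivity)]
      linarith
    refine le_trans ?_ this
    gcongr
  have h2 := Real.add_one_le_exp (-(κ / η * w))
  have h3 : Real.exp (-κ * (Real.log W' - l) / η) =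
      Real.exp (-κ * (Real.log W - l) / η) * Real.exp (-(κ / η * w)) := by
    rw [← Real.exp_add, hw]; congr 1; field_simp; ring
  rw [h3, ← mul_assoc]
  calc c - H' ≤ (c - H) * (-(κ / η * w) + 1) := by linarith
    _ ≤ (c - H) * Real.exp (-(κ / η * w)) := mul_le_mul_of_nonneg_left h2 h
    _ ≤ _ := mul_le_mul_of_nonneg_right hinv (Real.exp_pos _).le

/-- Each coordinate of `g` is a good estimate of the partial derivative at `x`. -/
def GoodGrad {n : ℕ} (f : Finset (Fin n) → ℝ) (a v : ℝ) (x g : Fin n → ℝ) : Prop :=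
  ∀ j, |g j - multilinearExt (marginal f j) x| ≤
    a * (multilinearExt (marginal f j) x + v / n)

/-- `y` is a good estimate of the value at `x`. -/
def GoodValue {n : ℕ} (f : Finset (Fin n) → ℝ) (a v : ℝ) (x : Fin n → ℝ) (y : ℝ) : Prop :=
  |y - multilinearExt f x| ≤ a * (gain f x + v)

/-! ### One step, and the invariant of a run with a suitable threshold. -/

section Step

variable {m n : ℕ} (P : StepParams m) (A : Matrix (Fin m) (Fin n) ℝ)

/-- The load is so high that `x` must not be increased any more. -/
def Frozen (x : Fin n → ℝ) : Prop := Real.exp (P.η * (1 - 2 * P.δ)) < load A P.η x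

/-- A step with threshold `T` and gradient estimate `g`: coordinates whose derivative is below
`T` times their price become inactive, the active ones are increased. -/
noncomputable def step (T : ℝ) (g : Fin n → ℝ) (σ : (Fin n → ℝ) × Finset (Fin n)) :
    (Fin n → ℝ) × Finset (Fin n) :=
  open Classical in
  if Frozen P A σ.1 then σ else
    (increment P.δ σ.1 (σ.2.filter fun j => T * price A P.η σ.1 j ≤ g j),
      σ.2.filter fun j => T * price A P.η σ.1 j ≤ g j)

variable {P A}

/-- Each constraint contributes one term to the load. The slack 2δ is what a single step can use up.
-/
theorem mulVec_le_of_not_frozen {x : Fin n → ℝ} (h : ¬Frozen P A x) (i : Fin m) :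
    (A *ᵥ x) i ≤ 1 - 2 * P.δ := by
  have := Real.exp_le_exp.1 ((exp_le_load (A := A) (η := P.η) x i).trans (not_lt.1 h))
  exact le_of_mul_le_mul_left this P.η_pos

theorem step_mem_feasible (hA : ∀ i j, 0 ≤ A i j ∧ A i j ≤ 1) (T : ℝ) (g : Fin n → ℝ)
    {σ : (Fin n → ℝ) × Finset (Fin n)} (h : σ.1 ∈ feasible A) :
    (step P A T g σ).1 ∈ feasible A := by
  classical
  unfold step
  split_ifs with hF
  · exact h
  · refine ⟨increment_mem_cube P.δ_pos.le h.1, fun i => ?_⟩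
    have h1 := mulVec_le_of_not_frozen hF i
    have h2 := mulVec_increment_le (S := σ.2.filter fun j => T * price A P.η σ.1 j ≤ g j) hA
      P.δ_pos.le h.1 (h.2 i)
    dsimp only
    linarith

/-- What is known about a run with threshold `T` after `s` steps of a phase, compared with a
gain of `V`. -/
structure Invariant (P : StepParams m) (A : Matrix (Fin m) (Fin n) ℝ)
    (f : Finset (Fin n) → ℝ) (v V T : ℝ) (s : ℕ) (σ : (Fin n → ℝ) × Finset (Fin n)) : Prop where
  feas : σ.1 ∈ feasible A
  decay : V * (1 - 3 * P.a) - progress f P.a P.δ v σ.1 ≤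
    V * Real.exp (-(1 - 4 * P.a) * (Real.log (load A P.η σ.1) - Real.log m) / P.η)
  active : ¬Frozen P A σ.1 →
    (1 - P.a) * (V * (1 - 2 * P.a) - gain f σ.1) ≤ T * load A P.η σ.1 ∧
    (∀ j ∈ σ.2, min (1 + 1 / (n : ℝ)) ((1 + P.δ) ^ s / n) ≤ σ.1 j + 1 / n) ∧
    ∀ j ∉ σ.2, (1 - P.a) * multilinearExt (marginal f j) σ.1 ≤
      T * price A P.η σ.1 j + P.a * (v / n)

variable {f : Finset (Fin n) → ℝ} {v V T : ℝ}

/-- Raised coordinates have derivative about T times price, so progress grows by about T/η times the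
growth of the load; with T W bounding the missing gain, this is the hypothesis of `decay_of_growth`.
The other clauses persist by monotonicity in x. -/
theorem Invariant.step (hf : IsMonotoneSubmodular f) (hA : ∀ i j, 0 ≤ A i j ∧ A i j ≤ 1)
    (hm : 0 < m) (hn : 0 < n) (hv0 : 0 ≤ v) (hv : ∀ j, multilinearExt (marginal f j) 0 ≤ v)
    (hvV : v ≤ V) (hT : 0 ≤ T) {s : ℕ} {σ : (Fin n → ℝ) × Finset (Fin n)}
    (h : Invariant P A f v V T s σ) {g : Fin n → ℝ} (hg : GoodGrad f P.a v σ.1 g) :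
    Invariant P A f v V T (s + 1) (step P A T g σ) := by
  classical
  have hA0 : ∀ i j, 0 ≤ A i j := fun i j => (hA i j).1
  have ha := P.a_pos
  have ha20 := P.a_le
  have hη := P.η_pos
  have hδ := P.δ_pos
  by_cases hF : Frozen P A σ.1
  · have e : PackingML.step P A T g σ = σ := if_pos hF
    rw [e]
    exact ⟨h.feas, h.decay, fun h' => absurd hF h'⟩
  obtain ⟨hthr, hgrow, hbad⟩ := h.active hF
  have hfeas := step_mem_feasible (P := P) hA T g h.feas
  have hx := h.feas.1
  set S := σ.2.filter fun j => T * price A P.η σ.1 j ≤ g j with hS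
  have e : PackingML.step P A T g σ = (increment P.δ σ.1 S, S) := if_neg hF
  rw [e] at hfeas ⊢
  set x := σ.1
  set y := increment P.δ x S with hy
  have hxy : ∀ j, x j ≤ y j := fun j => le_increment hδ.le hx j
  have hyc : y ∈ cube n := increment_mem_cube hδ.le hx
  have hW0 : 0 < load A P.η x :=
    lt_of_lt_of_le (by positivity) (load_ge hA0 hη.le fun j => (hx j).1)
  have hWW := load_mono hA0 hη.le hxy
  have hgain : gain f x ≤ gain f y := sub_le_sub_right (multilinearExt_mono hf.mono hx hyc hxy) _
  have hstep := progress_sub_le hf (a := P.a) (v := v) hδ.le hx hyc hxy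
    fun j => increment_sub_le hδ.le hx j
  have hvn : 0 ≤ v / n := by positivity
  refine ⟨hfeas, ?_, fun _ => ⟨?_, ?_, ?_⟩⟩
  · have hload := load_sub_le (A := A) hη.le (b := 2 * P.a) (by linarith)
      (fun i => mulVec_mono hA0 hxy i) fun i => by
        have := mul_le_mul_of_nonneg_left
          (mulVec_increment_le (S := S) hA hδ.le hx (h.feas.2 i)) hη.le
        linarith [P.η_mul_δ]
    -- Raised coordinates passed the test against the estimate `g`. Its relative error costs the
    -- factor 1 + a, its additive error is paid by the linear term of `progress`.
    have hmarg : T * ∑ j, (y j - x j) * price A P.η x j ≤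
        (1 + P.a) * ∑ j, (y j - x j) * (multilinearExt (marginal f j) x + P.a * (v / n)) := by
      rw [Finset.mul_sum, Finset.mul_sum]
      refine Finset.sum_le_sum fun j _ => ?_
      by_cases hj : j ∈ S
      · have h1 := (Finset.mem_filter.1 hj).2
        have h2 := (abs_le.1 (hg j)).2
        have h3 : T * price A P.η x j ≤
            (1 + P.a) * (multilinearExt (marginal f j) x + P.a * (v / n)) := by
          have : 0 ≤ P.a * (P.a * (v / n)) := by positivity
          linarith
        have := mul_le_mul_of_nonneg_left h3 (sub_nonneg.2 (hxy j))
        linarith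
      · simp [hy, increment_of_notMem hj]
    have hH0 : progress f P.a P.δ v x ≤ progress f P.a P.δ v y := by
      refine sub_nonneg.1 (le_trans (Finset.sum_nonneg fun j _ => ?_) hstep)
      exact mul_nonneg (sub_nonneg.2 (hxy j))
        (add_nonneg (hf.grad_nonneg j hx) (mul_nonneg ha.le hvn))
    refine decay_of_growth (hv0.trans hvV) (by linarith) hη hW0 hWW hH0 (fun hP => ?_) h.decay
    have hFH := gain_le_progress hf (a := P.a) hn ha.le hδ.le hv0 hv hx
    have hδv : P.δ * v ≤ P.a * V := mul_le_mul P.δ_le hvV hv0 ha.le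
    set H := progress f P.a P.δ v x
    set H' := progress f P.a P.δ v y
    set W := load A P.η x
    set W' := load A P.η y
    set Q := ∑ j, (y j - x j) * price A P.η x j
    set c := V * (1 - 3 * P.a) - H with hc
    -- The gain is at most progress + aV, which is why 2a in the threshold clause becomes 3a in the
    -- decay clause.
    have h1 : (1 - P.a) * c ≤ T * W := by
      refine le_trans (mul_le_mul_of_nonneg_left ?_ (by linarith)) hthr
      rw [hc]; linarith
    have h2 : T * Q ≤ (1 + P.a) * (H' - H) :=
      hmarg.trans (mul_le_mul_of_nonneg_left hstep (by linarith))
    have hWd : 0 ≤ W' - W := sub_nonneg.2 hWW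
    have h3 : T * (W' - W) ≤ P.η * (1 + 2 * P.a) * ((1 + P.a) * (H' - H)) :=
      calc T * (W' - W) ≤ T * (P.η * (1 + 2 * P.a) * Q) := mul_le_mul_of_nonneg_left hload hT
        _ = P.η * (1 + 2 * P.a) * (T * Q) := by ring
        _ ≤ _ := mul_le_mul_of_nonneg_left h2 (by positivity)
    have h4 : (1 - P.a) * (c * (W' - W)) ≤
        (1 + 2 * P.a) * (1 + P.a) * (P.η * W * (H' - H)) :=
      calc (1 - P.a) * (c * (W' - W)) = (1 - P.a) * c * (W' - W) := by ring
        _ ≤ T * W * (W' - W) := mul_le_mul_of_nonneg_right h1 hWd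
        _ = W * (T * (W' - W)) := by ring
        _ ≤ W * (P.η * (1 + 2 * P.a) * ((1 + P.a) * (H' - H))) :=
            mul_le_mul_of_nonneg_left h3 hW0.le
        _ = _ := by ring
    -- The losses from linearizing the load, from the estimates and from the threshold combine into
    -- the rate 1 - 4a.
    have h5 : (1 - 4 * P.a) * ((1 + 2 * P.a) * (1 + P.a)) ≤ 1 - P.a := by
      have : 0 ≤ P.a ^ 2 := by positivity
      have : 0 ≤ P.a ^ 3 := by positivity
      linarith
    have h6 := mul_le_mul_of_nonneg_right h5 (mul_nonneg hP hWd)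
    have h7 : (0 : ℝ) < (1 + 2 * P.a) * (1 + P.a) := by positivity
    refine le_of_mul_le_mul_left ?_ h7
    linarith
  · have h1 := mul_le_mul_of_nonneg_left hWW hT
    have h2 := mul_le_mul_of_nonneg_left (sub_le_sub_left hgain (V * (1 - 2 * P.a)))
      (show 0 ≤ 1 - P.a by linarith)
    exact h2.trans (hthr.trans h1)
  · intro j hj
    have hold := hgrow j (Finset.mem_filter.1 hj).1
    have ey : y j = min 1 (x j + P.δ * (x j + 1 / n)) := if_pos hj
    dsimp only
    rw [ey, ← min_add_add_right]
    refine le_min (min_le_left _ _) ?_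
    rcases le_total (1 + 1 / (n : ℝ)) ((1 + P.δ) ^ s / n) with hc | hc
    · rw [min_eq_left hc] at hold
      have := step_size_nonneg hδ.le hx j
      exact (min_le_left _ _).trans (by linarith)
    · rw [min_eq_right hc] at hold
      refine (min_le_right _ _).trans ?_
      have := mul_le_mul_of_nonneg_left hold (show 0 ≤ 1 + P.δ by linarith)
      rw [pow_succ]
      calc _ = (1 + P.δ) * ((1 + P.δ) ^ s / n) := by ring
        _ ≤ _ := this
        _ = _ := by ring
  · intro j hj
    have hq := mul_le_mul_of_nonneg_left (price_mono hA0 hη.le hxy j) hT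
    have hD := mul_le_mul_of_nonneg_left (hf.grad_anti j hx hyc hxy)
      (show 0 ≤ 1 - P.a by linarith)
    dsimp only at hj ⊢
    by_cases hj' : j ∈ σ.2
    · have h1 : g j < T * price A P.η x j := by
        rw [hS, Finset.mem_filter] at hj
        exact not_le.1 fun h => hj ⟨hj', h⟩
      have h2 := (abs_le.1 (hg j)).1
      linarith
    · linarith [hbad j hj']

/-- The next phase starts with a lower threshold, and with all coordinates active. -/
theorem Invariant.next_phase (hf : IsMonotoneSubmodular f)
    (hA : ∀ i j, 0 ≤ A i j ∧ A i j ≤ 1) (hn : 0 < n) (hv0 : 0 ≤ v) (hT : 0 ≤ T)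
    {z : Fin n → ℝ} (hz : z ∈ feasible A) (hvV : v ≤ gain f z) {N : ℕ}
    (hN : (n : ℝ) + 1 ≤ (1 + P.δ) ^ N) {σ : (Fin n → ℝ) × Finset (Fin n)}
    (h : Invariant P A f v (gain f z) T N σ) :
    Invariant P A f v (gain f z) ((1 - P.a) * T) 0 (σ.1, Finset.univ) := by
  have ha := P.a_pos
  have ha20 := P.a_le
  have hn' : (0 : ℝ) < n := by positivity
  refine ⟨h.feas, h.decay, fun hF => ⟨?_, fun j _ => ?_, fun j hj => absurd (Finset.mem_univ j) hj⟩⟩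
  · obtain ⟨-, hgrow, hbad⟩ := h.active hF
    have h1 := gain_gap_le hf (fun i j => (hA i j).1) ha.le (by linarith) hv0 hT h.feas.1 hz
      fun j => by
        by_cases hj : j ∈ σ.2
        · left
          -- After `N` steps the geometric lower bound for an active coordinate has passed its cap 1
          -- + 1/n, so the coordinate equals 1.
          have h2 := hgrow j hj
          have h3 : 1 + 1 / (n : ℝ) ≤ (1 + P.δ) ^ N / n := by
            rw [le_div_iff₀ hn']
            calc _ = (n : ℝ) + 1 := by field_simp
              _ ≤ _ := hN
          rw [min_eq_left h3] at h2
          exact le_antisymm (h.feas.1 j).2 (by linarith)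
        · exact Or.inr (hbad j hj)
    -- From (1 - a)(V - gain) ≤ T W + aV, dropping a · gain ≥ 0 leaves V(1 - 2a) - gain ≤ T W, the
    -- threshold clause for (1 - a) T.
    have h2 := gain_nonneg hf h.feas.1
    have h3 := mul_le_mul_of_nonneg_left hvV ha.le
    have h4 := mul_nonneg ha.le h2
    rw [mul_assoc]
    exact mul_le_mul_of_nonneg_left (by dsimp only; linarith) (by linarith)
  · have := (h.feas.1 j).1
    refine (min_le_right _ _).trans ?_
    rw [pow_zero]
    dsimp only
    linarith

/-- The state at the start satisfies the invariant when the threshold is at least `V`. -/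
theorem Invariant.start (hf : IsMonotoneSubmodular f) (hm : 0 < m) (hn : 0 < n)
    (hv : ∀ j, multilinearExt (marginal f j) 0 ≤ v) (hv0 : 0 ≤ v) (hvV : v ≤ V) (hVT : V ≤ T) :
    Invariant P A f v V T 0 (0, Finset.univ) := by
  have ha := P.a_pos
  have ha20 := P.a_le
  have hV := hv0.trans hvV
  refine ⟨⟨zero_mem_cube, fun i => by simp⟩, ?_, fun _ => ⟨?_, fun j _ => ?_,
    fun j hj => absurd (Finset.mem_univ j) hj⟩⟩
  · have h1 := neg_le_progress_zero hf (a := P.a) hn P.δ_pos.le hv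
    have hδv : P.δ * v ≤ P.a * V := mul_le_mul P.δ_le hvV hv0 ha.le
    have : 0 ≤ P.a * V := by positivity
    simp only [load_zero, sub_self, mul_zero, zero_div, Real.exp_zero]
    linarith
  · have h1 : gain f 0 = 0 := sub_self _
    have h2 : (1 : ℝ) ≤ m := by exact_mod_cast hm
    have h3 : (0 : ℝ) ≤ V * P.a := by positivity
    have h4 : (0 : ℝ) ≤ V * P.a ^ 2 := by positivity
    dsimp only
    rw [load_zero, h1]
    nlinarith [mul_le_mul hVT h2 zero_le_one (hV.trans hVT)]
  · simp

/-- At the end, the gain is nearly a `1 - 1/e` fraction of the optimum. -/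
theorem Invariant.finish (hf : IsMonotoneSubmodular f) (hn : 0 < n)
    (hv0 : 0 ≤ v) (hvV : v ≤ V) (hT0 : 0 ≤ T) (hT : T * Real.exp P.η ≤ P.a / 2 * V)
    {s : ℕ} {σ : (Fin n → ℝ) × Finset (Fin n)} (h : Invariant P A f v V T s σ) :
    (1 - 1 / Real.exp 1 - 11 * P.a) * V ≤ gain f σ.1 := by
  have ha := P.a_pos
  have ha20 := P.a_le
  have hη := P.η_pos
  have hδ := P.δ_pos
  have hV := hv0.trans hvV
  have haV : 0 ≤ P.a * V := by positivity
  have he : Real.exp (-1) = 1 / Real.exp 1 := by rw [Real.exp_neg, one_div]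
  have he2 : 1 / Real.exp 1 ≤ 0.368 := by
    rw [← he]; linarith [Real.exp_neg_one_lt_d9]
  have he0 : 0 < 1 / Real.exp 1 := by positivity
  by_cases hF : Frozen P A σ.1
  -- Frozen: the logarithm of the load has grown by at least η(1 - 3a), so the missing progress is
  -- at most exp(-1 + 7a) V.
  · have h1 : P.η * (1 - 2 * P.δ) ≤ Real.log (load A P.η σ.1) :=
      (Real.le_log_iff_exp_le ((Real.exp_pos _).trans hF)).2 hF.le
    have h2 : -(1 - 4 * P.a) * (Real.log (load A P.η σ.1) - Real.log m) / P.η ≤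
        -1 + 7 * P.a := by
      rw [div_le_iff₀ hη]
      have h3 : P.η * (1 - 3 * P.a) ≤ Real.log (load A P.η σ.1) - Real.log m := by
        have := mul_le_mul_of_nonneg_left P.δ_le hη.le
        linarith [P.log_le]
      have h4 := mul_le_mul_of_nonneg_left h3 (show 0 ≤ 1 - 4 * P.a by linarith)
      have : 0 ≤ P.η * P.a ^ 2 := by positivity
      linarith
    have h5 : Real.exp (-1 + 7 * P.a) ≤ 1 / Real.exp 1 + 6 * P.a := by
      rw [Real.exp_add, he]
      have h6 := (abs_le.1 (Real.abs_exp_sub_one_sub_id_le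
        (abs_le.2 ⟨by linarith, by linarith⟩ : |7 * P.a| ≤ 1))).2
      have h7 : Real.exp (7 * P.a) ≤ 1 + 14 * P.a := by nlinarith
      have h8 := mul_le_mul_of_nonneg_left h7 he0.le
      have h9 := mul_le_mul_of_nonneg_right he2 ha.le
      linarith
    have h6 := mul_le_mul_of_nonneg_left ((Real.exp_le_exp.2 h2).trans h5) hV
    have h7 := progress_le hf hn ha.le hδ.le hv0 h.feas.1
    have h8 := h.decay
    have h9 := mul_le_mul_of_nonneg_left hvV ha.le
    set G := gain f σ.1
    have hle : V * (1 - 1 / Real.exp 1 - 10 * P.a) ≤ (1 + P.δ) * G := by linarith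
    -- A gain above V is more than enough. Otherwise δ · gain ≤ aV, which turns the loss 10a into
    -- 11a.
    rcases le_total V G with hG | hG
    · have : (1 - 1 / Real.exp 1 - 11 * P.a) * V ≤ 1 * V :=
        mul_le_mul_of_nonneg_right (by linarith) hV
      linarith
    · have : P.δ * G ≤ P.a * V := mul_le_mul P.δ_le hG (gain_nonneg hf h.feas.1) ha.le
      linarith
  -- Not frozen: the load is at most exp η, so T W ≤ aV/2 and the gap is at most 3aV.
  · obtain ⟨h1, -, -⟩ := h.active hF
    have h2 : load A P.η σ.1 ≤ Real.exp P.η := (not_lt.1 hF).trans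
      (Real.exp_le_exp.2 (mul_le_of_le_one_right hη.le (by linarith)))
    have h3 := mul_le_mul_of_nonneg_left h2 hT0
    have h4 : (1 - P.a) * (V * (1 - 2 * P.a) - gain f σ.1) ≤ (1 - P.a) * (P.a * V) := by
      have : 0 ≤ (1 / 2 - P.a) * (P.a * V) := mul_nonneg (by linarith) haV
      linarith
    have h5 := le_of_mul_le_mul_left h4 (by linarith)
    have : 0 ≤ 1 / Real.exp 1 * V := by positivity
    linarith

end Step

/-! ### A Chernoff bound with relative and additive error, on finite product spaces. -/

section Chernoff

variable {I Ω : Type} [Fintype I] [DecidableEq I] [Fintype Ω] {w : I → Ω → ℝ}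

theorem sum_prod_weight (w φ : I → Ω → ℝ) :
    ∑ ω : I → Ω, (∏ i, w i (ω i)) * ∏ i, φ i (ω i) = ∏ i, ∑ S, w i S * φ i S := by
  rw [Finset.prod_univ_sum, Fintype.piFinset_univ]
  exact Finset.sum_congr rfl fun ω _ => Finset.prod_mul_distrib.symm

theorem sum_prod_weight_one (hw1 : ∀ i, ∑ S, w i S = 1) :
    ∑ ω : I → Ω, ∏ i, w i (ω i) = 1 := by
  have := sum_prod_weight w fun _ _ => 1
  simpa [hw1] using this

theorem exp_mul_le {τ x : ℝ} (hτ : |τ| ≤ 1) (h0 : 0 ≤ x) (h1 : x ≤ 1) :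
    Real.exp (τ * x) ≤ 1 + x * (τ + τ ^ 2) := by
  have h2 : |τ * x| ≤ 1 := by
    rw [abs_mul, abs_of_nonneg h0]; exact mul_le_one₀ hτ h0 h1
  have h3 := (abs_le.1 (Real.abs_exp_sub_one_sub_id_le h2)).2
  have h4 : x ^ 2 ≤ x := by nlinarith
  have h5 := mul_le_mul_of_nonneg_left h4 (sq_nonneg τ)
  linarith [mul_pow τ x 2]

/-- A one-sided Chernoff bound with relative error `τ` and additive error `τ * s`. -/
theorem chernoff_one_sided (hw0 : ∀ i S, 0 ≤ w i S) (hw1 : ∀ i, ∑ S, w i S = 1)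
    {X : I → Ω → ℝ} (hX0 : ∀ i S, 0 ≤ X i S) (hX1 : ∀ i S, X i S ≤ 1) {τ : ℝ} (hτ : |τ| ≤ 1)
    (s : ℝ) :
    (∑ ω : I → Ω, if τ ^ 2 * ((∑ i, ∑ S, w i S * X i S) + s) <
        τ * ((∑ i, X i (ω i)) - ∑ i, ∑ S, w i S * X i S) then ∏ i, w i (ω i) else 0) ≤
      Real.exp (-(τ ^ 2 * s)) := by
  obtain ⟨M, hM⟩ : ∃ M, M = ∑ i, ∑ S, w i S * X i S := ⟨_, rfl⟩
  rw [← hM]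
  have hprod0 : ∀ ω : I → Ω, 0 ≤ ∏ i, w i (ω i) := fun ω =>
    Finset.prod_nonneg fun i _ => hw0 i _
  -- Markov's inequality for exp(τ ΣX), followed by independence. The sign of `τ` selects the tail.
  calc _ ≤ ∑ ω : I → Ω, (∏ i, w i (ω i)) *
        (Real.exp (-(τ ^ 2 * (M + s) + τ * M)) * ∏ i, Real.exp (τ * X i (ω i))) := by
        refine Finset.sum_le_sum fun ω _ => ?_
        split_ifs with h
        · refine le_mul_of_one_le_right (hprod0 ω) ?_
          rw [← Real.exp_sum, ← Real.exp_add, ← Finset.mul_sum]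
          exact Real.one_le_exp (by linarith)
        · exact mul_nonneg (hprod0 ω) (by positivity)
    _ = Real.exp (-(τ ^ 2 * (M + s) + τ * M)) *
        ∏ i, ∑ S, w i S * Real.exp (τ * X i S) := by
        rw [← sum_prod_weight w fun i S => Real.exp (τ * X i S), Finset.mul_sum]
        exact Finset.sum_congr rfl fun ω _ => by ring
    _ ≤ Real.exp (-(τ ^ 2 * (M + s) + τ * M)) *
        ∏ i, Real.exp ((∑ S, w i S * X i S) * (τ + τ ^ 2)) := by
        refine mul_le_mul_of_nonneg_left (Finset.prod_le_prod (fun i _ =>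
          Finset.sum_nonneg fun S _ => mul_nonneg (hw0 i S) (Real.exp_pos _).le)
          fun i _ => ?_) (Real.exp_pos _).le
        refine le_trans ?_ (Real.add_one_le_exp _)
        calc _ ≤ ∑ S, w i S * (1 + X i S * (τ + τ ^ 2)) := Finset.sum_le_sum fun S _ =>
              mul_le_mul_of_nonneg_left (exp_mul_le hτ (hX0 i S) (hX1 i S)) (hw0 i S)
          _ = _ := by
              simp only [mul_add, mul_one, Finset.sum_add_distrib, hw1 i, Finset.sum_mul]
              simp only [← mul_assoc]
              ring
    _ = Real.exp (-(τ ^ 2 * s)) := by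
        rw [← Real.exp_sum, ← Real.exp_add, ← Finset.sum_mul, ← hM]
        congr 1; ring

/-- Both tails of the variables divided by B, with τ = θ and τ = -θ. If B = 0, all variables vanish
and no deviation occurs. -/
theorem chernoff (hw0 : ∀ i S, 0 ≤ w i S) (hw1 : ∀ i, ∑ S, w i S = 1)
    {X : I → Ω → ℝ} {B : ℝ} (hB0 : 0 ≤ B) (hX0 : ∀ i S, 0 ≤ X i S) (hXB : ∀ i S, X i S ≤ B) {θ : ℝ}
    (hθ0 : 0 < θ) (hθ : θ ≤ 1) (s : ℝ) :
    (∑ ω : I → Ω, if θ * ((∑ i, ∑ S, w i S * X i S) + s * B) <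
        |(∑ i, X i (ω i)) - ∑ i, ∑ S, w i S * X i S| then ∏ i, w i (ω i) else 0) ≤
      2 * Real.exp (-(θ ^ 2 * s)) := by
  have hprod0 : ∀ ω : I → Ω, 0 ≤ ∏ i, w i (ω i) := fun ω =>
    Finset.prod_nonneg fun i _ => hw0 i _
  rcases hB0.lt_or_eq with hB | rfl
  · have hY0 : ∀ i S, 0 ≤ X i S / B := fun i S => div_nonneg (hX0 i S) hB.le
    have hY1 : ∀ i S, X i S / B ≤ 1 := fun i S => (div_le_one hB).2 (hXB i S)
    have h1 := chernoff_one_sided hw0 hw1 hY0 hY1 (τ := θ)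
      (abs_le.2 ⟨by linarith, hθ⟩) s
    have h2 := chernoff_one_sided hw0 hw1 hY0 hY1 (τ := -θ)
      (abs_le.2 ⟨by linarith, by linarith⟩) s
    have eM : ∑ i, ∑ S, w i S * (X i S / B) = (∑ i, ∑ S, w i S * X i S) / B := by
      simp only [Finset.sum_div, mul_div_assoc]
    simp only [eM, ← Finset.sum_div, neg_sq, ← sub_div] at h1 h2
    set M := ∑ i, ∑ S, w i S * X i S
    rw [two_mul]
    refine le_trans ?_ (add_le_add h1 h2)
    rw [← Finset.sum_add_distrib]
    refine Finset.sum_le_sum fun ω _ => ?_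
    have e1 : θ ^ 2 * (M / B + s) = θ * (θ * (M + s * B)) / B := by field_simp
    have c1 : θ ^ 2 * (M / B + s) < θ * ((∑ i, X i (ω i) - M) / B) ↔
        θ * (M + s * B) < ∑ i, X i (ω i) - M := by
      rw [e1, ← mul_div_assoc, div_lt_div_iff_of_pos_right hB, mul_lt_mul_iff_right₀ hθ0]
    have c2 : θ ^ 2 * (M / B + s) < -θ * ((∑ i, X i (ω i) - M) / B) ↔
        θ * (M + s * B) < -(∑ i, X i (ω i) - M) := by
      rw [e1, ← mul_div_assoc, div_lt_div_iff_of_pos_right hB, neg_mul, ← mul_neg,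
        mul_lt_mul_iff_right₀ hθ0]
    have := hprod0 ω
    simp only [c1, c2, lt_abs]
    by_cases d1 : θ * (M + s * B) < ∑ i, X i (ω i) - M <;>
    by_cases d2 : θ * (M + s * B) < -(∑ i, X i (ω i) - M) <;>
    simp [d1, d2, -neg_sub, this]
  · have hX : ∀ i S, X i S = 0 := fun i S => le_antisymm (hXB i S) (hX0 i S)
    simp only [hX, mul_zero, Finset.sum_const_zero, add_zero, sub_zero, abs_zero, lt_self_iff_false,
      if_false]
    positivity

end Chernoff

/-! ### Estimates from random sets. -/

section Sampling

variable {n : ℕ}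

/-- The law of independent random sets, the `i`-th one with marginals `x i`. -/
noncomputable def samplePMF {I : Type} [Fintype I] [DecidableEq I] (x : I → cube n) :
    PMF (I → Finset (Fin n)) :=
  PMF.ofFintype (fun ω => ENNReal.ofReal (∏ i, setWeight (x i) (ω i))) (by
    rw [← ENNReal.ofReal_sum_of_nonneg fun ω _ =>
      Finset.prod_nonneg fun i _ => setWeight_nonneg (x i).2 _,
      sum_prod_weight_one (w := fun i => setWeight (x i : Fin n → ℝ)) fun i => sum_setWeight _,
      ENNReal.ofReal_one])

theorem toReal_samplePMF_bind {I X : Type} [Fintype I] [DecidableEq I] (x : I → cube n)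
    (k : (I → Finset (Fin n)) → PMF X) (E : Set X) :
    (((samplePMF x).bind k).toOuterMeasure E).toReal =
      ∑ ω, (∏ i, setWeight (x i) (ω i)) * ((k ω).toOuterMeasure E).toReal := by
  have hk : ∀ ω, (k ω).toOuterMeasure E ≠ ∞ := fun ω => by
    refine ne_top_of_le_ne_top ENNReal.one_ne_top ?_
    rw [PMF.toOuterMeasure_apply, ← (k ω).tsum_coe]
    exact ENNReal.tsum_le_tsum fun a => Set.indicator_le_self _ _ _
  rw [PMF.toOuterMeasure_bind_apply, tsum_fintype, ENNReal.toReal_sum fun ω _ =>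
    ENNReal.mul_ne_top (by simp [samplePMF]) (hk ω)]
  refine Finset.sum_congr rfl fun ω _ => ?_
  rw [ENNReal.toReal_mul]
  congr 1
  exact ENNReal.toReal_ofReal (Finset.prod_nonneg fun i _ => setWeight_nonneg (x i).2 _)

/-- The mean of `s` samples of a bounded function is close to the multilinear extension, up to a
relative error and an additive error. -/
theorem chernoff_sample {G s : ℕ} (hs : 0 < s) (x : Fin G → cube n) (g : Fin G)
    {h : Finset (Fin n) → ℝ} {B : ℝ} (hB0 : 0 ≤ B) (h0 : ∀ S, 0 ≤ h S) (hB : ∀ S, h S ≤ B)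
    {θ : ℝ} (hθ0 : 0 < θ) (hθ : θ ≤ 1) :
    (∑ ω : Fin G × Fin s → Finset (Fin n), if θ * (multilinearExt h (x g) + B / n) <
        |(∑ k, h (ω (g, k))) / s - multilinearExt h (x g)|
        then ∏ i, setWeight (x i.1) (ω i) else 0) ≤
      2 * Real.exp (-(θ ^ 2 * (s / n))) := by
  -- Samples drawn for other points count as zero. The additive parameter s/n becomes the error θB/n
  -- after division by the number `s` of samples.
  have key := chernoff (w := fun i : Fin G × Fin s => setWeight (x i.1 : Fin n → ℝ))
    (fun i => setWeight_nonneg (x i.1).2) (fun i => sum_setWeight _)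
    (X := fun i S => if i.1 = g then h S else 0) hB0
    (fun i S => by split_ifs; exacts [h0 S, le_rfl])
    (fun i S => by split_ifs; exacts [hB S, hB0]) hθ0 hθ (s / n)
  have e1 : ∑ i : Fin G × Fin s, ∑ S, setWeight (x i.1 : Fin n → ℝ) S *
      (if i.1 = g then h S else 0) = s * multilinearExt h (x g) := by
    rw [Fintype.sum_prod_type, Finset.sum_eq_single g (fun b _ hb => by simp [hb]) (by simp)]
    simp [multilinearExt_eq]
  have e2 : ∀ ω : Fin G × Fin s → Finset (Fin n),
      ∑ i : Fin G × Fin s, (if i.1 = g then h (ω i) else 0) = ∑ k, h (ω (g, k)) := fun ω => by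
    rw [Fintype.sum_prod_type, Finset.sum_eq_single g (fun b _ hb => by simp [hb]) (by simp)]
    simp
  simp only [e1, e2] at key
  refine le_trans (le_of_eq (Finset.sum_congr rfl fun ω _ => ?_)) key
  have hs' : (0 : ℝ) < s := by positivity
  congr 1
  rw [eq_iff_iff, ← mul_lt_mul_iff_right₀ hs', ← abs_of_pos hs', ← abs_mul, abs_of_pos hs']
  rw [show (s : ℝ) * ((∑ k, h (ω (g, k))) / s - multilinearExt h (x g)) =
    ∑ k, h (ω (g, k)) - s * multilinearExt h (x g) by field_simp]
  rw [show (s : ℝ) * (θ * (multilinearExt h (x g) + B / n)) =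
    θ * (s * multilinearExt h (x g) + s / n * B) by ring]

theorem marginal_le {f : Finset (Fin n) → ℝ} (hf : IsMonotoneSubmodular f) {v : ℝ}
    (hv : ∀ j, multilinearExt (marginal f j) 0 ≤ v) (j : Fin n) (S : Finset (Fin n)) :
    marginal f j S ≤ v :=
  (hf.marginal_anti j ∅ S (Finset.empty_subset S)).trans
    ((multilinearExt_zero (marginal f j)).symm.le.trans (hv j))

theorem sub_empty_le {f : Finset (Fin n) → ℝ} (hf : IsMonotoneSubmodular f) {v : ℝ}
    (hv : ∀ j, multilinearExt (marginal f j) 0 ≤ v) (hv0 : 0 ≤ v) (S : Finset (Fin n)) :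
    f S - f ∅ ≤ n * v := by
  have h : f S - f ∅ ≤ S.card * v := by
    induction S using Finset.induction_on with
    | empty => simp
    | insert j S hj ih =>
      have := marginal_le hf hv j S
      rw [marginal, Finset.erase_eq_of_notMem hj] at this
      rw [Finset.card_insert_of_notMem hj]
      push_cast
      linarith
  have h2 : (S.card : ℝ) ≤ n := by exact_mod_cast (Finset.card_le_univ S).trans (by simp)
  exact h.trans (mul_le_mul_of_nonneg_right h2 hv0)

theorem multilinearExt_sub_const (f : Finset (Fin n) → ℝ) (c : ℝ) (x : Fin n → ℝ) :
    multilinearExt (fun S => f S - c) x = multilinearExt f x - c := by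
  simp only [multilinearExt_eq, mul_sub, Finset.sum_sub_distrib, ← Finset.sum_mul,
    sum_setWeight, one_mul]

/-- All estimates of values and derivatives in an answer are good. -/
def GoodAnswer {G : ℕ} (f : Finset (Fin n) → ℝ) (a v : ℝ) (p : Fin G → cube n)
    (r : Fin G → ℝ × (Fin n → ℝ)) : Prop :=
  ∀ g, GoodValue f a v (p g) (r g).1 ∧ GoodGrad f a v (p g) (r g).2

/-- Estimates of values and derivatives from samples. -/
noncomputable def sampleAnswer {G s : ℕ} (O : Finset (Fin n) → ℝ)
    (ω : Fin G × Fin s → Finset (Fin n)) (g : Fin G) : ℝ × (Fin n → ℝ) :=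
  ((∑ k, O (ω (g, k))) / s, fun j => (∑ k, marginal O j (ω (g, k))) / s)

-- Union bound for finite weighted sums.
open Classical in
theorem sum_bad_le {Ω ι : Type} [Fintype Ω] [Fintype ι] {w : Ω → ℝ} (hw : ∀ ω, 0 ≤ w ω)
    {good : Ω → Prop} {bad : ι → Ω → Prop} (h : ∀ ω, (∀ i, ¬bad i ω) → good ω) {c : ℝ}
    (hc : ∀ i, (∑ ω, if bad i ω then w ω else 0) ≤ c) :
    (∑ ω, if good ω then 0 else w ω) ≤ Fintype.card ι * c := by
  have h0 : ∀ ω i, 0 ≤ if bad i ω then w ω else 0 := fun ω i => by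
    split_ifs
    exacts [hw ω, le_rfl]
  calc _ ≤ ∑ ω, ∑ i, if bad i ω then w ω else 0 := by
        refine Finset.sum_le_sum fun ω _ => ?_
        split_ifs with hg
        · exact Finset.sum_nonneg fun i _ => h0 ω i
        · obtain ⟨i, hi⟩ : ∃ i, bad i ω := by
            by_contra! hc
            exact hg (h ω hc)
          refine le_trans (le_of_eq ?_)
            (Finset.single_le_sum (fun i _ => h0 ω i) (Finset.mem_univ i))
          rw [if_pos hi]
    _ ≤ ∑ _i : ι, c := by
        rw [Finset.sum_comm]
        exact Finset.sum_le_sum fun i _ => hc i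
    _ = _ := by simp

open Classical in
theorem bad_sample_le {G s : ℕ} (hs : 0 < s) (hn : 0 < n) (x : Fin G → cube n)
    {f : Finset (Fin n) → ℝ} (hf : IsMonotoneSubmodular f) {a v : ℝ} (ha : 0 < a) (ha1 : a ≤ 1)
    (hv : ∀ j, multilinearExt (marginal f j) 0 ≤ v) (hv0 : 0 ≤ v) :
    (∑ ω : Fin G × Fin s → Finset (Fin n), if GoodAnswer f a v x (sampleAnswer f ω) then 0
        else ∏ i, setWeight (x i.1) (ω i)) ≤
      G * (n + 1) * (2 * Real.exp (-(a ^ 2 * (s / n)))) := by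
  have hs' : (s : ℝ) ≠ 0 := by positivity
  have hn' : (n : ℝ) ≠ 0 := by positivity
  -- `none` stands for the value, shifted by `f ∅` so that its range is [0, nv] and its additive
  -- error a v; `some j` stands for a derivative, with range [0, v] and additive error a v/n.
  let h : Option (Fin n) → Finset (Fin n) → ℝ := fun o =>
    o.elim (fun S => f S - f ∅) fun j => marginal f j
  let B : Option (Fin n) → ℝ := fun o => o.elim (n * v) fun _ => v
  have hB0 : ∀ o, 0 ≤ B o := by
    rintro (_ | j)
    · exact mul_nonneg (Nat.cast_nonneg n) hv0
    · exact hv0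
  have h0 : ∀ o S, 0 ≤ h o S := by
    rintro (_ | j) S
    · exact sub_nonneg.2 (hf.mono _ _ (Finset.empty_subset S))
    · exact hf.marginal_nonneg j S
  have hB : ∀ o S, h o S ≤ B o := by
    rintro (_ | j) S
    · exact sub_empty_le hf hv hv0 S
    · exact marginal_le hf hv j S
  have hw0 : ∀ ω : Fin G × Fin s → Finset (Fin n), 0 ≤ ∏ i, setWeight (x i.1 : Fin n → ℝ) (ω i) :=
    fun ω => Finset.prod_nonneg fun i _ => setWeight_nonneg (x i.1).2 _
  have key := sum_bad_le hw0 (good := fun ω => GoodAnswer f a v x (sampleAnswer f ω))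
    (bad := fun (p : Fin G × Option (Fin n)) ω =>
      a * (multilinearExt (h p.2) (x p.1) + B p.2 / n) <
        |(∑ k, h p.2 (ω (p.1, k))) / s - multilinearExt (h p.2) (x p.1)|)
    (c := 2 * Real.exp (-(a ^ 2 * (s / n)))) (fun ω hc => ?_) fun p => ?_
  · refine key.trans (le_of_eq ?_)
    simp
  · refine fun g => ⟨?_, fun j => not_lt.1 (hc (g, some j))⟩
    have h1 := not_lt.1 (hc (g, none))
    simp only [h, B, Option.elim_none, multilinearExt_sub_const, Finset.sum_sub_distrib,
      Finset.sum_const, Finset.card_univ, Fintype.card_fin, nsmul_eq_mul] at h1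
    have e1 : (∑ k, f (ω (g, k)) - s * f ∅) / s - (multilinearExt f (x g) - f ∅) =
        (∑ k, f (ω (g, k))) / s - multilinearExt f (x g) := by
      field_simp
      ring
    rw [e1, mul_div_cancel_left₀ v hn', ← multilinearExt_zero f] at h1
    exact h1
  · convert chernoff_sample hs x p.1 (hB0 p.2) (h0 p.2) (hB p.2) ha ha1

end Sampling

/-! ### Dialogues: algorithms separated from the way their questions are answered. -/

/-- An algorithm that asks questions of type `P` and gets answers of type `R`. -/
inductive Dialogue (P R X : Type) : Type
  | output (x : X) : Dialogue P R X
  | ask (p : P) (next : R → Dialogue P R X) : Dialogue P R X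

namespace Dialogue

variable {P R X Q : Type}

/-- As long as all answers are good, the output satisfies `E`. -/
def Safe (good : P → R → Prop) (E : X → Prop) : Dialogue P R X → Prop
  | output x => E x
  | ask p next => ∀ r, good p r → (next r).Safe good E

/-- At most `k` questions are asked. -/
def DepthLE : ℕ → Dialogue P R X → Prop
  | _, output _ => True
  | 0, ask _ _ => False
  | k + 1, ask _ next => ∀ r, (next r).DepthLE k

/-- Replace each question by a piece of an oracle algorithm. -/
def compile (impl : P → (R → OracleAlg Q X) → OracleAlg Q X) : Dialogue P R X → OracleAlg Q X
  | output x => .output x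
  | ask p next => impl p fun r => (next r).compile impl

theorem rounds_compile_le {impl : P → (R → OracleAlg Q X) → OracleAlg Q X} {O : Q → ℝ}
    (himpl : ∀ p k (b : ℕ∞), (∀ r, (k r).rounds O ≤ b) → (impl p k).rounds O ≤ 1 + b)
    {N : ℕ} {D : Dialogue P R X} (hD : D.DepthLE N) : (D.compile impl).rounds O ≤ N := by
  induction D generalizing N with
  | output x => exact zero_le
  | ask p next ih =>
    cases N with
    | zero => exact hD.elim
    | succ N =>
      refine (himpl p _ N fun r => ih r (hD r)).trans (le_of_eq ?_)
      push_cast; ring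

theorem queries_compile_le {impl : P → (R → OracleAlg Q X) → OracleAlg Q X} {O : Q → ℝ} {c : ℕ}
    (himpl : ∀ p k (b : ℕ∞), (∀ r, (k r).queries O ≤ b) → (impl p k).queries O ≤ c + b)
    {N : ℕ} {D : Dialogue P R X} (hD : D.DepthLE N) :
    (D.compile impl).queries O ≤ (N * c : ℕ) := by
  induction D generalizing N with
  | output x => exact zero_le
  | ask p next ih =>
    cases N with
    | zero => exact hD.elim
    | succ N =>
      refine (himpl p _ (N * c : ℕ) fun r => ih r (hD r)).trans (le_of_eq ?_)
      push_cast; ring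

theorem isDeterministic_compile {impl : P → (R → OracleAlg Q X) → OracleAlg Q X}
    (himpl : ∀ p k, (∀ r, (k r).IsDeterministic) → (impl p k).IsDeterministic)
    (D : Dialogue P R X) : (D.compile impl).IsDeterministic := by
  induction D with
  | output x => trivial
  | ask p next ih => exact himpl p _ ih

theorem run_compile_eq_pure {impl : P → (R → OracleAlg Q X) → OracleAlg Q X} {O : Q → ℝ}
    {good : P → R → Prop} (himpl : ∀ p, ∃ r, good p r ∧ ∀ k, (impl p k).run O = (k r).run O)
    {E : X → Prop} {D : Dialogue P R X} (hD : D.Safe good E) :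
    ∃ x, (D.compile impl).run O = PMF.pure x ∧ E x := by
  induction D with
  | output x => exact ⟨x, rfl, hD⟩
  | ask p next ih =>
    obtain ⟨r, hr, h⟩ := himpl p
    obtain ⟨x, hx, hE⟩ := ih r (hD r hr)
    exact ⟨x, (h _).trans hx, hE⟩

/-- Each question adds its failure probability `β`, as in a union bound along a path. The bound on
`impl` holds for every continuation, which lets it be iterated although later questions depend on
earlier answers. -/
theorem success_compile {impl : P → (R → OracleAlg Q X) → OracleAlg Q X} {O : Q → ℝ}
    {good : P → R → Prop} {E : X → Prop} {β : ℝ} (hβ : 0 ≤ β)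
    (himpl : ∀ p k (b : ℝ), 0 ≤ b →
      (∀ r, good p r → 1 - b ≤ (((k r).run O).toOuterMeasure {x | E x}).toReal) →
      1 - (b + β) ≤ (((impl p k).run O).toOuterMeasure {x | E x}).toReal)
    {N : ℕ} {D : Dialogue P R X} (hN : D.DepthLE N) (hD : D.Safe good E) :
    1 - N * β ≤ (((D.compile impl).run O).toOuterMeasure {x | E x}).toReal := by
  induction D generalizing N with
  | output x =>
    have hE : E x := hD
    simp only [compile, OracleAlg.run, PMF.toOuterMeasure_pure_apply, Set.mem_ofPred_eq, hE,
      if_true, ENNReal.toReal_one]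
    have := mul_nonneg (Nat.cast_nonneg (α := ℝ) N) hβ
    linarith
  | ask p next ih =>
    cases N with
    | zero => exact hN.elim
    | succ N =>
      refine le_trans (le_of_eq ?_) (himpl p _ (N * β) (by positivity) fun r hr =>
        ih r (hN r) (hD r hr))
      push_cast; ring

end Dialogue

/-! ### Answering questions by exact queries or by sampling. -/

section Implementations

variable {n G : ℕ} {X : Type}

open Classical in
/-- The answers to a batch, as a function of all queries. -/
noncomputable def extendAnswer {Q : Type} (B : Finset Q) (a : {q // q ∈ B} → ℝ) (q : Q) : ℝ :=
  if h : q ∈ B then a ⟨q, h⟩ else 0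

theorem extendAnswer_apply {Q : Type} {B : Finset Q} (O : Q → ℝ) {q : Q} (hq : q ∈ B) :
    extendAnswer B (fun q => O q) q = O q := dif_pos hq

open Classical in
/-- The values and all partial derivatives at given points. -/
noncomputable def exactBatch (p : Fin G → cube n) : Finset (MLQuery n) :=
  Finset.univ.image fun i : Fin G × Option (Fin n) =>
    i.2.elim (.value (p i.1)) fun j => .grad j (p i.1)

/-- Read off values and gradients. -/
def exactAnswer (p : Fin G → cube n) (O : MLQuery n → ℝ) (g : Fin G) : ℝ × (Fin n → ℝ) :=
  (O (.value (p g)), fun j => O (.grad j (p g)))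

/-- Ask for values and gradients in one round. -/
noncomputable def exactImpl (p : Fin G → cube n)
    (k : (Fin G → ℝ × (Fin n → ℝ)) → OracleAlg (MLQuery n) X) : OracleAlg (MLQuery n) X :=
  .round (exactBatch p) fun a => k (exactAnswer p (extendAnswer _ a))

theorem card_exactBatch_le (p : Fin G → cube n) : (exactBatch p).card ≤ G * (n + 1) := by
  classical
  exact Finset.card_image_le.trans (by simp)

theorem value_mem_exactBatch (p : Fin G → cube n) (g : Fin G) :
    .value (p g) ∈ exactBatch p := by
  classical
  exact Finset.mem_image.2 ⟨(g, none), Finset.mem_univ _, rfl⟩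

theorem grad_mem_exactBatch (p : Fin G → cube n) (g : Fin G) (j : Fin n) :
    .grad j (p g) ∈ exactBatch p := by
  classical
  exact Finset.mem_image.2 ⟨(g, some j), Finset.mem_univ _, rfl⟩

theorem exactAnswer_extend (p : Fin G → cube n) (O : MLQuery n → ℝ) :
    exactAnswer p (extendAnswer (exactBatch p) fun q => O q) = exactAnswer p O := by
  funext g
  unfold exactAnswer
  rw [extendAnswer_apply O (value_mem_exactBatch p g)]
  congr 1
  funext j
  exact extendAnswer_apply O (grad_mem_exactBatch p g j)

theorem run_exactImpl (O : MLQuery n → ℝ) (p : Fin G → cube n)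
    (k : (Fin G → ℝ × (Fin n → ℝ)) → OracleAlg (MLQuery n) X) :
    (exactImpl p k).run O = (k (exactAnswer p O)).run O := by
  simp only [exactImpl, OracleAlg.run, exactAnswer_extend]

theorem goodAnswer_exactAnswer {f : Finset (Fin n) → ℝ} (hf : IsMonotoneSubmodular f) {a v : ℝ}
    (ha : 0 ≤ a) (hv0 : 0 ≤ v) (p : Fin G → cube n) :
    GoodAnswer f a v p (exactAnswer p (mlOracle f)) := by
  refine fun g => ⟨?_, fun j => ?_⟩
  · have := gain_nonneg hf (p g).2
    simp only [GoodValue, exactAnswer, mlOracle, sub_self, abs_zero]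
    positivity
  · have := hf.grad_nonneg j (p g).2
    simp only [exactAnswer, mlOracle, multilinearGrad_eq, sub_self, abs_zero]
    positivity

open Classical in
/-- All sets whose values are needed for the estimates from given samples. -/
noncomputable def sampleBatch {s : ℕ} (ω : Fin G × Fin s → Finset (Fin n)) :
    Finset (Finset (Fin n)) :=
  Finset.univ.image fun i : (Fin G × Fin s) × Option (Fin n × Bool) =>
    i.2.elim (ω i.1) fun jb => if jb.2 then insert jb.1 (ω i.1) else (ω i.1).erase jb.1

/-- Estimate values and gradients from `s` samples for each point, in one round. -/
noncomputable def sampleImpl (s : ℕ) (p : Fin G → cube n)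
    (k : (Fin G → ℝ × (Fin n → ℝ)) → OracleAlg (Finset (Fin n)) X) :
    OracleAlg (Finset (Fin n)) X :=
  .coin (Fin G × Fin s → Finset (Fin n)) (samplePMF fun i => p i.1) fun ω =>
    .round (sampleBatch ω) fun a => k (sampleAnswer (extendAnswer _ a) ω)

theorem card_sampleBatch_le {s : ℕ} (ω : Fin G × Fin s → Finset (Fin n)) :
    (sampleBatch ω).card ≤ G * s * (n * 2 + 1) :=
  Finset.card_image_le.trans (by simp)

theorem mem_sampleBatch {s : ℕ} (ω : Fin G × Fin s → Finset (Fin n)) (i : Fin G × Fin s) :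
    ω i ∈ sampleBatch ω :=
  Finset.mem_image.2 ⟨(i, none), Finset.mem_univ _, rfl⟩

theorem insert_mem_sampleBatch {s : ℕ} (ω : Fin G × Fin s → Finset (Fin n)) (i : Fin G × Fin s)
    (j : Fin n) : insert j (ω i) ∈ sampleBatch ω :=
  Finset.mem_image.2 ⟨(i, some (j, true)), Finset.mem_univ _, by simp⟩

theorem erase_mem_sampleBatch {s : ℕ} (ω : Fin G × Fin s → Finset (Fin n)) (i : Fin G × Fin s)
    (j : Fin n) : (ω i).erase j ∈ sampleBatch ω :=
  Finset.mem_image.2 ⟨(i, some (j, false)), Finset.mem_univ _, by simp⟩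

theorem sampleAnswer_extend {s : ℕ} (ω : Fin G × Fin s → Finset (Fin n))
    (O : Finset (Fin n) → ℝ) :
    sampleAnswer (extendAnswer (sampleBatch ω) fun q => O q) ω = sampleAnswer O ω := by
  funext g
  unfold sampleAnswer marginal
  congr 1
  · congr 1
    exact Finset.sum_congr rfl fun k _ => extendAnswer_apply O (mem_sampleBatch ω (g, k))
  · funext j
    congr 1
    exact Finset.sum_congr rfl fun k _ => congrArg₂ _
      (extendAnswer_apply O (insert_mem_sampleBatch ω (g, k) j))
      (extendAnswer_apply O (erase_mem_sampleBatch ω (g, k) j))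

theorem success_sampleImpl {s : ℕ} (hs : 0 < s) (hn : 0 < n) {f : Finset (Fin n) → ℝ}
    (hf : IsMonotoneSubmodular f) {a v : ℝ} (ha : 0 < a) (ha1 : a ≤ 1)
    (hv : ∀ j, multilinearExt (marginal f j) 0 ≤ v) (hv0 : 0 ≤ v) (E : X → Prop)
    (p : Fin G → cube n) (k : (Fin G → ℝ × (Fin n → ℝ)) → OracleAlg (Finset (Fin n)) X) (b : ℝ)
    (hb : 0 ≤ b)
    (hk : ∀ r, GoodAnswer f a v p r →
      1 - b ≤ (((k r).run f).toOuterMeasure {x | E x}).toReal) :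
    1 - (b + G * (n + 1) * (2 * Real.exp (-(a ^ 2 * (s / n))))) ≤
      (((sampleImpl s p k).run f).toOuterMeasure {x | E x}).toReal := by
  classical
  simp only [sampleImpl, OracleAlg.run, toReal_samplePMF_bind, sampleAnswer_extend]
  have h1 := bad_sample_le hs hn p hf ha ha1 hv hv0
  have h2 := sum_prod_weight_one (I := Fin G × Fin s) (w := fun i => setWeight (p i.1 : Fin n → ℝ))
    fun i => sum_setWeight _
  have h3 : ∑ ω : Fin G × Fin s → Finset (Fin n), ((1 - b) * ∏ i, setWeight (p i.1) (ω i) -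
      if GoodAnswer f a v p (sampleAnswer f ω) then 0 else ∏ i, setWeight (p i.1) (ω i)) ≤
      ∑ ω : Fin G × Fin s → Finset (Fin n), (∏ i, setWeight (p i.1) (ω i)) *
        (((k (sampleAnswer f ω)).run f).toOuterMeasure {x | E x}).toReal := by
    refine Finset.sum_le_sum fun ω _ => ?_
    have hw : 0 ≤ ∏ i, setWeight (p i.1 : Fin n → ℝ) (ω i) :=
      Finset.prod_nonneg fun i _ => setWeight_nonneg (p i.1).2 _
    split_ifs with hg
    · have := mul_le_mul_of_nonneg_left (hk _ hg) hw
      linarith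
    · have := mul_nonneg hw (ENNReal.toReal_nonneg
        (a := ((k (sampleAnswer f ω)).run f).toOuterMeasure {x | E x}))
      have := mul_nonneg hb hw
      linarith
  rw [Finset.sum_sub_distrib, ← Finset.mul_sum, h2] at h3
  linarith

end Implementations

/-- The projection to the cube. -/
noncomputable def clip {n : ℕ} (x : Fin n → ℝ) : cube n :=
  ⟨fun i => max 0 (min 1 (x i)), fun _ => ⟨le_max_left _ _, max_le zero_le_one (min_le_left _ _)⟩⟩

theorem coe_clip {n : ℕ} {x : Fin n → ℝ} (hx : x ∈ cube n) : (clip x : Fin n → ℝ) = x :=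
  funext fun i => by simp [clip, (hx i).1, (hx i).2]

namespace Dialogue

variable {P R X : Type} {good : P → R → Prop}

/-- The dialogue does not depend on the point it is compared with; only the analysis, including the
choice of the right guess, does. So one run competes with all points at once. -/
theorem Safe.forall {ι : Type} {E : ι → X → Prop} {D : Dialogue P R X}
    (h : ∀ i, D.Safe good (E i)) : D.Safe good fun x => ∀ i, E i x := by
  induction D with
  | output x => exact h
  | ask p next ih => exact fun r hr => ih r fun i => h i r hr

theorem Safe.imp {E E' : X → Prop} (hE : ∀ x, E x → E' x) {D : Dialogue P R X}
    (h : D.Safe good E) : D.Safe good E' := by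
  induction D with
  | output x => exact hE x h
  | ask p next ih => exact fun r hr => ih r (h r hr)

end Dialogue

/-! ### The algorithm and its correctness for good answers. -/

section Algorithm

variable {m n G : ℕ} (P : StepParams m) (A : Matrix (Fin m) (Fin n) ℝ)

/-- `k` steps with thresholds `T`, for all guesses in parallel. -/
noncomputable def runSteps (T : Fin G → ℝ)
    (cont : (Fin G → (Fin n → ℝ) × Finset (Fin n)) →
      Dialogue (Fin G → cube n) (Fin G → ℝ × (Fin n → ℝ)) (Fin n → ℝ)) :
    ℕ → (Fin G → (Fin n → ℝ) × Finset (Fin n)) →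
      Dialogue (Fin G → cube n) (Fin G → ℝ × (Fin n → ℝ)) (Fin n → ℝ)
  | 0, σ => cont σ
  | k + 1, σ => .ask (fun g => clip (σ g).1) fun r =>
      runSteps T cont k fun g => step P A (T g) (r g).2 (σ g)

/-- `k` phases of `N` steps each, with decreasing thresholds, and the choice of the best guess. -/
noncomputable def runPhases (N : ℕ) :
    ℕ → (Fin (G + 1) → ℝ) → (Fin (G + 1) → (Fin n → ℝ) × Finset (Fin n)) →
      Dialogue (Fin (G + 1) → cube n) (Fin (G + 1) → ℝ × (Fin n → ℝ)) (Fin n → ℝ)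
  | 0, _, σ => .ask (fun g => clip (σ g).1) fun r =>
      .output (σ (Finite.exists_max fun g => (r g).1).choose).1
  | k + 1, T, σ => runSteps P A T (fun τ => runPhases N k (fun g => (1 - P.a) * T g)
      fun g => ((τ g).1, Finset.univ)) N σ

/-- The whole algorithm: guess the scale of the optimum, then run `K` phases of `N` steps. -/
noncomputable def solve (G N K : ℕ) :
    Dialogue (Fin (G + 1) → cube n) (Fin (G + 1) → ℝ × (Fin n → ℝ)) (Fin n → ℝ) :=
  .ask (fun _ => clip 0) fun r =>
    runPhases P A N K (fun g => 2 ^ (g.val + 1) * ⨆ j, (r 0).2 j) fun _ => (0, Finset.univ)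

variable {P A}

theorem depthLE_runSteps {T : Fin G → ℝ}
    {cont : (Fin G → (Fin n → ℝ) × Finset (Fin n)) →
      Dialogue (Fin G → cube n) (Fin G → ℝ × (Fin n → ℝ)) (Fin n → ℝ)} {d : ℕ}
    (hc : ∀ σ, (cont σ).DepthLE d) (k : ℕ) (σ : Fin G → (Fin n → ℝ) × Finset (Fin n)) :
    (runSteps P A T cont k σ).DepthLE (d + k) := by
  induction k generalizing σ with
  | zero => exact hc σ
  | succ k ih => exact fun r => ih _

theorem depthLE_runPhases (N k : ℕ) (T : Fin (G + 1) → ℝ)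
    (σ : Fin (G + 1) → (Fin n → ℝ) × Finset (Fin n)) :
    (runPhases P A N k T σ).DepthLE (k * N + 1) := by
  induction k generalizing T σ with
  | zero => exact fun _ => by rw [Dialogue.DepthLE.eq_def]; trivial
  | succ k ih =>
    rw [show (k + 1) * N + 1 = k * N + 1 + N by ring]
    exact depthLE_runSteps (fun τ => ih _ _) N σ

/-- The two extra questions are the gradient at the origin and the final comparison of values. -/
theorem depthLE_solve (G N K : ℕ) : (solve P A G N K).DepthLE (K * N + 2) :=
  fun _ => depthLE_runPhases N K _ _

variable {f : Finset (Fin n) → ℝ} {v : ℝ}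

/-- Only the guess `g₀` of the right scale carries the invariant. The others need to stay feasible,
since any of them may be selected. -/
theorem safe_runSteps (hf : IsMonotoneSubmodular f) (hA : ∀ i j, 0 ≤ A i j ∧ A i j ≤ 1)
    (hm : 0 < m) (hn : 0 < n) (hv0 : 0 ≤ v) (hv : ∀ j, multilinearExt (marginal f j) 0 ≤ v)
    {V : ℝ} (hvV : v ≤ V) {T : Fin G → ℝ} {g₀ : Fin G} (hT : 0 ≤ T g₀)
    {cont : (Fin G → (Fin n → ℝ) × Finset (Fin n)) →
      Dialogue (Fin G → cube n) (Fin G → ℝ × (Fin n → ℝ)) (Fin n → ℝ)}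
    {E : (Fin n → ℝ) → Prop} {N : ℕ}
    (hc : ∀ σ, (∀ g, (σ g).1 ∈ feasible A) → Invariant P A f v V (T g₀) N (σ g₀) →
      (cont σ).Safe (GoodAnswer f P.a v) E)
    (k s : ℕ) (hks : s + k = N) (σ : Fin G → (Fin n → ℝ) × Finset (Fin n))
    (hσ : ∀ g, (σ g).1 ∈ feasible A) (hinv : Invariant P A f v V (T g₀) s (σ g₀)) :
    (runSteps P A T cont k σ).Safe (GoodAnswer f P.a v) E := by
  induction k generalizing σ s with
  | zero => exact hc σ hσ (by rw [← hks]; exact hinv)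
  | succ k ih =>
    refine fun r hr => ih (s + 1) (by omega) _ (fun g => step_mem_feasible hA _ _ (hσ g)) ?_
    have := (hr g₀).2
    rw [coe_clip (hσ g₀).1] at this
    exact hinv.step hf hA hm hn hv0 hv hvV hT this

/-- The best estimate belongs to a nearly best point. -/
theorem gain_le_of_best {a c V x y : ℝ} (ha : 0 ≤ a) (hv0 : 0 ≤ v) (hvV : v ≤ V)
    (hc1 : c ≤ 1) (ha1 : a ≤ 1) (hx : c * V ≤ x)
    (hxy : x - a * (x + v) ≤ y + a * (y + v)) : (c - 4 * a) * V ≤ y := by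
  have hV := hv0.trans hvV
  have h1 := mul_le_mul_of_nonneg_left hx (sub_nonneg.2 ha1)
  have h2 := mul_le_mul_of_nonneg_left hvV ha
  have h3 : a * (c * V) ≤ a * (1 * V) := by gcongr
  rcases le_total V y with h | h
  · have : (c - 4 * a) * V ≤ 1 * V := by gcongr; linarith
    linarith
  · have := mul_le_mul_of_nonneg_left h ha
    linarith

theorem safe_runPhases (hf : IsMonotoneSubmodular f) (hA : ∀ i j, 0 ≤ A i j ∧ A i j ≤ 1)
    (hm : 0 < m) (hn : 0 < n) (hv0 : 0 ≤ v) (hv : ∀ j, multilinearExt (marginal f j) 0 ≤ v)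
    {z : Fin n → ℝ} (hz : z ∈ feasible A) (hvV : v ≤ gain f z) {N : ℕ}
    (hN : (n : ℝ) + 1 ≤ (1 + P.δ) ^ N) {g₀ : Fin (G + 1)} (k : ℕ) {T : Fin (G + 1) → ℝ}
    (hT : 0 ≤ T g₀)
    (hTk : T g₀ * (1 - P.a) ^ k * Real.exp P.η ≤ P.a / 2 * gain f z)
    {σ : Fin (G + 1) → (Fin n → ℝ) × Finset (Fin n)}
    (hσ : ∀ g, (σ g).1 ∈ feasible A) (hinv : Invariant P A f v (gain f z) (T g₀) 0 (σ g₀)) :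
    (runPhases P A N k T σ).Safe (GoodAnswer f P.a v) fun x => x ∈ feasible A ∧
      (1 - 1 / Real.exp 1 - 15 * P.a) * gain f z ≤ gain f x := by
  have ha := P.a_pos
  have ha20 := P.a_le
  induction k generalizing T σ with
  | zero =>
    intro r hr
    refine ⟨hσ _, ?_⟩
    have hb := (Finite.exists_max fun g => (r g).1).choose_spec g₀
    set b := (Finite.exists_max fun g => (r g).1).choose
    rw [pow_zero, mul_one] at hTk
    have h0 := hinv.finish hf hn hv0 hvV hT hTk
    have h1 := (abs_le.1 (hr g₀).1).1
    have h2 := (abs_le.1 (hr b).1).2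
    rw [coe_clip (hσ _).1] at h1 h2
    have he : 1 / Real.exp 1 ≤ 0.368 := by
      rw [one_div, ← Real.exp_neg]; linarith [Real.exp_neg_one_lt_d9]
    have he0 : 0 < 1 / Real.exp 1 := by positivity
    -- Selecting by estimated values costs another 4a, so 11a becomes 15a.
    have := gain_le_of_best (y := gain f (σ b).1) ha.le hv0 hvV (by linarith)
      (by linarith) h0 (by unfold gain at *; linarith)
    refine le_trans (le_of_eq ?_) this
    ring
  | succ k ih =>
    have hρ : 0 ≤ 1 - P.a := by linarith
    rw [runPhases]
    refine safe_runSteps hf hA hm hn hv0 hv hvV hT (fun τ hτ hτi =>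
      ih (T := fun g => (1 - P.a) * T g) (σ := fun g => ((τ g).1, Finset.univ)) ?_ ?_ hτ ?_) N 0
      (zero_add N) σ hσ hinv
    · positivity
    · refine le_trans (le_of_eq ?_) hTk
      ring
    · exact hτi.next_phase hf hA hn hv0 hT hz hvV hN

/-- Take the least exponent that reaches V: the power before it fails, so the overshoot is at most
2V, or else the first guess already works and 2w ≤ 4v ≤ 4V. -/
theorem exists_scale {G : ℕ} {v V w : ℝ} (hV : V ≤ n * v) (hG : n ≤ 2 ^ G) (hvV : v ≤ V)
    (hv0 : 0 ≤ v) (hw1 : v / 2 ≤ w) (hw2 : w ≤ 2 * v) :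
    ∃ g : Fin (G + 1), V ≤ 2 ^ (g.val + 1) * w ∧ 2 ^ (g.val + 1) * w ≤ 4 * V := by
  classical
  have hGV : V ≤ 2 ^ (G + 1) * w := by
    have h1 : (n : ℝ) ≤ 2 ^ G := by exact_mod_cast hG
    have h2 := mul_le_mul_of_nonneg_right h1 hv0
    have h3 := mul_le_mul_of_nonneg_left hw1 (show (0 : ℝ) ≤ 2 ^ (G + 1) by positivity)
    rw [pow_succ] at h3 ⊢
    linarith
  have hex : ∃ g, V ≤ 2 ^ (g + 1) * w := ⟨G, hGV⟩
  have hle : Nat.find hex ≤ G := Nat.find_min' hex hGV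
  refine ⟨⟨Nat.find hex, by omega⟩, Nat.find_spec hex, ?_⟩
  dsimp only
  rcases h : Nat.find hex with _ | k
  · rw [zero_add, pow_one]
    linarith
  · have := not_le.1 (Nat.find_min hex (m := k) (by omega))
    rw [pow_succ]
    linarith

theorem safe_solve (hf : IsMonotoneSubmodular f) (hA : ∀ i j, 0 ≤ A i j ∧ A i j ≤ 1)
    (hm : 0 < m) (hn : 0 < n) (hv0 : 0 ≤ v) (hv : ∀ j, multilinearExt (marginal f j) 0 ≤ v)
    (hv1 : ∃ j, multilinearExt (marginal f j) 0 = v) {G N K : ℕ} (hG : n ≤ 2 ^ G)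
    (hN : (n : ℝ) + 1 ≤ (1 + P.δ) ^ N)
    (hK : 4 * (1 - P.a) ^ K * Real.exp P.η ≤ P.a / 2) :
    (solve P A G N K).Safe (GoodAnswer f P.a v) fun x => x ∈ feasible A ∧
      ∀ z ∈ feasible A, (1 - 1 / Real.exp 1 - 15 * P.a) * gain f z ≤ gain f x := by
  have ha := P.a_pos
  have ha20 := P.a_le
  obtain ⟨j₁, hj₁⟩ := hv1
  have hn' : (1 : ℝ) ≤ n := by exact_mod_cast hn
  have : Nonempty (Fin n) := ⟨j₁⟩
  have hvn : v / n ≤ v := div_le_self hv0 hn'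
  -- the unit vector of the best single element
  set u : Fin n → ℝ := Function.update 0 j₁ 1 with hu
  have hu01 : ∀ j, 0 ≤ u j ∧ u j ≤ 1 := fun j => by
    by_cases h : j = j₁
    · subst h; simp [hu]
    · simp [hu, h]
  have hufeas : u ∈ feasible A := by
    refine ⟨hu01, fun i => ?_⟩
    rw [show u = Pi.single j₁ 1 from rfl, Matrix.mulVec_single_one]
    exact (hA i j₁).2
  have hugain : gain f u = v := by
    rw [gain, hu, multilinearExt_update, hj₁]
    simp
  -- With v ≤ gain z, the additive errors in `v` can be charged to the gain of `z`.
  have key : ∀ z : {z : Fin n → ℝ // z ∈ feasible A ∧ v ≤ gain f z},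
      (solve P A G N K).Safe (GoodAnswer f P.a v) fun x => x ∈ feasible A ∧
        (1 - 1 / Real.exp 1 - 15 * P.a) * gain f z ≤ gain f x := by
    rintro ⟨z, hz, hvV⟩ r hr
    have hV0 := hv0.trans hvV
    have hr0 := (hr 0).2
    rw [coe_clip zero_mem_cube] at hr0
    have hup : ∀ j, (r 0).2 j ≤ 2 * v := fun j => by
      have h1 := (abs_le.1 (hr0 j)).2
      have h2 : P.a * (multilinearExt (marginal f j) 0 + v / n) ≤ 1 / 20 * (v + v) := by
        gcongr
        · exact add_nonneg (hf.grad_nonneg j zero_mem_cube) (by positivity)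
        · exact hv j
      linarith [hv j]
    have hlow : v / 2 ≤ (r 0).2 j₁ := by
      have h1 := (abs_le.1 (hr0 j₁)).1
      have h2 : P.a * (v + v / n) ≤ 1 / 20 * (v + v) := by gcongr
      rw [hj₁] at h1
      linarith
    have hw1 : v / 2 ≤ ⨆ j, (r 0).2 j := hlow.trans (le_ciSup (Set.finite_range _).bddAbove j₁)
    obtain ⟨g₀, hg1, hg2⟩ := exists_scale (gain_le hf hv hz.1) hG hvV hv0 hw1 (ciSup_le hup)
    refine safe_runPhases hf hA hm hn hv0 hv hz hvV hN (g₀ := g₀) K (hV0.trans hg1) ?_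
      (fun _ => ⟨zero_mem_cube, fun i => by simp⟩) (Invariant.start hf hm hn hv hv0 hvV hg1)
    have hρ : 0 ≤ 1 - P.a := by linarith
    calc _ ≤ 4 * gain f z * (1 - P.a) ^ K * Real.exp P.η := by gcongr
      _ = 4 * (1 - P.a) ^ K * Real.exp P.η * gain f z := by ring
      _ ≤ _ := by gcongr
  refine (Dialogue.Safe.forall key).imp fun x hx => ?_
  -- The unit vector is feasible and has gain exactly `v`, so competing with it settles all points
  -- of smaller gain.
  have hxu := hx ⟨u, hufeas, hugain.ge⟩
  refine ⟨hxu.1, fun z hz => ?_⟩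
  rcases le_total v (gain f z) with h | h
  · exact (hx ⟨z, hz, h⟩).2
  · rcases le_total 0 (1 - 1 / Real.exp 1 - 15 * P.a) with hc | hc
    · refine le_trans (mul_le_mul_of_nonneg_left ?_ hc) hxu.2
      rw [hugain]; exact h
    · exact (mul_nonpos_of_nonpos_of_nonneg hc (gain_nonneg hf hz.1)).trans
        (gain_nonneg hf hxu.1.1)

/-- A guarantee for the gain implies the guarantee for the value. -/
theorem isApproxSolution_of_gain (hf : IsMonotoneSubmodular f) {α β : ℝ} (hαβ : α ≤ β)
    (hα : α ≤ 1) {x : Fin n → ℝ} (hx : x ∈ feasible A)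
    (h : ∀ z ∈ feasible A, β * gain f z ≤ gain f x) : IsApproxSolution A f α x := by
  refine ⟨hx, fun z hz => ?_⟩
  have h1 := h z hz
  have h2 := mul_le_mul_of_nonneg_right hαβ (gain_nonneg hf hz.1)
  have h3 : 0 ≤ multilinearExt f (0 : Fin n → ℝ) := multilinearExt_nonneg hf.nonneg zero_mem_cube
  have h4 := mul_le_mul_of_nonneg_right hα h3
  unfold gain at *
  linarith

end Algorithm

/-! ### Choice of the parameters, and numerical bounds. -/

section Parameters

theorem log_two_le_log_max (m : ℕ) : Real.log 2 ≤ Real.log (max (m : ℝ) 2) :=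
  Real.log_le_log (by norm_num) (le_max_right _ _)

/-- The parameters for accuracy `ε`. -/
noncomputable def stepParams (m : ℕ) (ε : ℝ) (hε : 0 < ε ∧ ε < 1) : StepParams m where
  a := ε / 20
  η := Real.log (max (m : ℝ) 2) / (ε / 20)
  δ := (ε / 20) ^ 2 / Real.log (max (m : ℝ) 2)
  a_pos := by linarith [hε.1]
  a_le := by linarith [hε.2]
  η_pos := by
    have := log_two_le_log_max m
    have := Real.log_two_gt_d9
    exact div_pos (by linarith) (by linarith [hε.1])
  δ_pos := by
    have := log_two_le_log_max m
    have := Real.log_two_gt_d9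
    exact div_pos (pow_pos (by linarith [hε.1]) 2) (by linarith)
  η_mul_δ := by
    have := log_two_le_log_max m
    have := Real.log_two_gt_d9
    have h1 : Real.log (max (m : ℝ) 2) ≠ 0 := by linarith
    have h2 := hε.1.ne'
    field_simp
  δ_le := by
    have := log_two_le_log_max m
    have := Real.log_two_gt_d9
    rw [div_le_iff₀ (by linarith), pow_two]
    exact mul_le_mul_of_nonneg_left (by linarith [hε.2]) (by linarith [hε.1])
  log_le := by
    rw [mul_div_cancel₀ _ (by linarith [hε.1] : ε / 20 ≠ 0)]
    rcases Nat.eq_zero_or_pos m with rfl | hm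
    · simp [Real.log_nonneg]
    · exact Real.log_le_log (by exact_mod_cast hm) (le_max_left _ _)

/-- The number of phases. -/
noncomputable def numPhases (m : ℕ) (ε : ℝ) : ℕ :=
  ⌈(Real.log (max (m : ℝ) 2) / (ε / 20) + 8 / (ε / 20)) / (ε / 20)⌉₊

/-- The number of steps in a phase. -/
noncomputable def numSteps (n m : ℕ) (ε : ℝ) : ℕ :=
  ⌈2 * Real.log ((n : ℝ) + 1) / ((ε / 20) ^ 2 / Real.log (max (m : ℝ) 2))⌉₊

/-- The number of rounds. -/
noncomputable def numRounds (n m : ℕ) (ε : ℝ) : ℕ := numPhases m ε * numSteps n m ε + 2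

variable {n m : ℕ} {ε : ℝ}

theorem numSteps_spec (hε : 0 < ε ∧ ε < 1) :
    (n : ℝ) + 1 ≤ (1 + (stepParams m ε hε).δ) ^ numSteps n m ε := by
  set P := stepParams m ε hε with hP
  have hδ := P.δ_pos
  have hδ1 : P.δ ≤ 1 := by linarith [P.δ_le, P.a_le]
  have h1 : 2 * Real.log ((n : ℝ) + 1) / P.δ ≤ numSteps n m ε := Nat.le_ceil _
  rw [div_le_iff₀ hδ] at h1
  -- This accounts for the factor 2 in `numSteps`.
  have h2 : Real.exp (P.δ / 2) ≤ 1 + P.δ := by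
    have := (abs_le.1 (Real.abs_exp_sub_one_sub_id_le
      (abs_le.2 ⟨by linarith, by linarith⟩ : |P.δ / 2| ≤ 1))).2
    nlinarith
  calc (n : ℝ) + 1 = Real.exp (Real.log ((n : ℝ) + 1)) := (Real.exp_log (by positivity)).symm
    _ ≤ Real.exp (numSteps n m ε * (P.δ / 2)) := Real.exp_le_exp.2 (by linarith)
    _ = Real.exp (P.δ / 2) ^ numSteps n m ε := Real.exp_nat_mul _ _
    _ ≤ _ := pow_le_pow_left₀ (Real.exp_pos _).le h2 _

theorem numPhases_spec (hε : 0 < ε ∧ ε < 1) :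
    4 * (1 - (stepParams m ε hε).a) ^ numPhases m ε * Real.exp (stepParams m ε hε).η ≤
      (stepParams m ε hε).a / 2 := by
  set P := stepParams m ε hε with hP
  have ha := P.a_pos
  have ha20 := P.a_le
  have h1 : (P.η + 8 / P.a) / P.a ≤ numPhases m ε := Nat.le_ceil _
  rw [div_le_iff₀ ha] at h1
  have h2 : (1 - P.a) ^ numPhases m ε ≤ Real.exp (-(P.η + 8 / P.a)) :=
    calc (1 - P.a) ^ numPhases m ε ≤ Real.exp (-P.a) ^ numPhases m ε :=
          pow_le_pow_left₀ (by linarith) (by linarith [Real.add_one_le_exp (-P.a)]) _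
      _ = Real.exp (numPhases m ε * -P.a) := (Real.exp_nat_mul _ _).symm
      _ ≤ _ := Real.exp_le_exp.2 (by linarith)
  -- The threshold has to fall from 4V to (a/2) V exp(-η). The summand η of the exponent gives
  -- exp(-η), and 8/a gives the remaining factor a/8.
  have h3 : Real.exp (-(8 / P.a)) ≤ P.a / 8 := by
    rw [Real.exp_neg, show P.a / 8 = (8 / P.a)⁻¹ from (inv_div _ _).symm]
    exact inv_anti₀ (by positivity) (by linarith [Real.add_one_le_exp (8 / P.a)])
  calc _ ≤ 4 * Real.exp (-(P.η + 8 / P.a)) * Real.exp P.η := by gcongr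
    _ = 4 * Real.exp (-(8 / P.a)) := by
        rw [mul_assoc, ← Real.exp_add]; congr 2; ring
    _ ≤ _ := by linarith

theorem log_two_le_log (hn : 2 ≤ n) : Real.log 2 ≤ Real.log n :=
  Real.log_le_log (by norm_num) (by exact_mod_cast hn)

theorem log_succ_le (hn : 2 ≤ n) : Real.log ((n : ℝ) + 1) ≤ 2 * Real.log n := by
  have h : (2 : ℝ) ≤ n := by exact_mod_cast hn
  have := Real.log_le_log (by positivity) (show (n : ℝ) + 1 ≤ n ^ 2 by nlinarith)
  rwa [Real.log_pow] at this

theorem numRounds_le (hn : 2 ≤ n) (hε : 0 < ε ∧ ε < 1) :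
    (numRounds n m ε : ℝ) ≤ 80 * 20 ^ 4 * roundBound n m ε := by
  have hl := log_two_le_log hn
  have hL := log_two_le_log_max m
  have h2 := Real.log_two_gt_d9
  have hln := log_succ_le hn
  have ha0 : 0 < ε / 20 := by linarith [hε.1]
  have ha1 : ε / 20 ≤ 1 / 20 := by linarith [hε.2]
  have hb : roundBound n m ε * 20 ^ 4 =
      Real.log (max (m : ℝ) 2) ^ 2 * Real.log n / (ε / 20) ^ 4 := by
    have := hε.1.ne'
    unfold roundBound
    field_simp
  rw [mul_assoc, mul_comm ((20 : ℝ) ^ 4), hb]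
  unfold numRounds numPhases numSteps
  set L := Real.log (max (m : ℝ) 2)
  set l := Real.log n
  set a := ε / 20
  have hL0 : 0 < L := by linarith
  have hl0 : 0 < l := by linarith
  have haa : a ^ 2 ≤ 1 / 400 := by nlinarith
  have h1 : (⌈(L / a + 8 / a) / a⌉₊ : ℝ) ≤ 15 * L / a ^ 2 := by
    refine (Nat.ceil_lt_add_one (by positivity)).le.trans ?_
    have e : (L / a + 8 / a) / a + 1 = (L + 8 + a ^ 2) / a ^ 2 := by field_simp
    rw [e]
    gcongr
    linarith
  have h3 : (⌈2 * Real.log ((n : ℝ) + 1) / (a ^ 2 / L)⌉₊ : ℝ) ≤ 5 * (l * L) / a ^ 2 := by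
    have h0 : 0 ≤ Real.log ((n : ℝ) + 1) := Real.log_nonneg (by linarith [n.cast_nonneg (α := ℝ)])
    refine (Nat.ceil_lt_add_one (by positivity)).le.trans ?_
    have e : 2 * Real.log ((n : ℝ) + 1) / (a ^ 2 / L) + 1 =
        (2 * Real.log ((n : ℝ) + 1) * L + a ^ 2) / a ^ 2 := by field_simp
    rw [e]
    gcongr
    have := mul_le_mul_of_nonneg_right hln hL0.le
    nlinarith
  have h4 := mul_le_mul h1 h3 (Nat.cast_nonneg _) (by positivity)
  have h5 : 15 * L / a ^ 2 * (5 * (l * L) / a ^ 2) = 75 * (L ^ 2 * l / a ^ 4) := by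
    field_simp; norm_num
  -- Phases times steps give 15 · 5 = 75, and the two extra rounds raise this to 80.
  have h6 : 2 ≤ 5 * (L ^ 2 * l / a ^ 4) := by
    have e1 : a ^ 4 ≤ 1 / 400 * (1 / 400) := by
      rw [show a ^ 4 = a ^ 2 * a ^ 2 by ring]
      exact mul_le_mul haa haa (by positivity) (by positivity)
    have e2 : 0.6 * 0.6 * 0.6 ≤ L ^ 2 * l := by
      rw [pow_two]
      gcongr <;> linarith
    rw [← mul_div_assoc, le_div_iff₀ (by positivity)]
    linarith
  rw [h5] at h4
  push_cast
  linarith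

/-- The basic quantity in the query bounds. -/
theorem polylog_eq (k : ℕ) : polylog k n m ε = polylog 1 n m ε ^ k := by
  simp [polylog]

/-- Both logarithms are at least log 2 and 1/ε > 1, so their product dominates each of them up to a
constant. -/
theorem bounds_by_polylog (hn : 2 ≤ n) (hε : 0 < ε ∧ ε < 1) :
    0 < polylog 1 n m ε ∧ 1 ≤ 3 * polylog 1 n m ε ∧ Real.log n ≤ 2 * polylog 1 n m ε ∧
      Real.log (max (m : ℝ) 2) ≤ 2 * polylog 1 n m ε ∧ 1 / ε ≤ 3 * polylog 1 n m ε := by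
  have hl := log_two_le_log hn
  have hL := log_two_le_log_max m
  have h2 := Real.log_two_gt_d9
  simp only [polylog, pow_one]
  set L := Real.log (max (m : ℝ) 2)
  set l := Real.log n
  have hε1 : 1 ≤ 1 / ε := (one_le_div hε.1).2 hε.2.le
  rw [show l * L / ε = l * L * (1 / ε) by ring]
  set t := 1 / ε
  have hl0 : 0.6 ≤ l := by linarith
  have hL0 : 0.6 ≤ L := by linarith
  have hlL : 0.36 ≤ l * L := by nlinarith
  have e1 : l * L ≤ l * L * t := le_mul_of_one_le_right (by linarith) hε1
  have e2 : (1 / 3 : ℝ) ≤ l * L := by linarith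
  have e3 := mul_le_mul_of_nonneg_right e2 (show 0 ≤ t by linarith)
  refine ⟨by linarith, by linarith, ?_, ?_, by linarith⟩ <;> nlinarith

/-- The number of guesses is `numScales n + 1`. -/
def numScales (n : ℕ) : ℕ := Nat.clog 2 n

theorem numScales_le (hn : 2 ≤ n) : (numScales n : ℝ) + 1 ≤ 5 * Real.log n := by
  have hl := log_two_le_log hn
  have h2 := Real.log_two_gt_d9
  have h1 : 2 ^ (Nat.clog 2 n - 1) < n := Nat.pow_pred_clog_lt_self (by norm_num) (by omega)
  have h3 : (2 : ℝ) ^ (Nat.clog 2 n - 1) ≤ n := by exact_mod_cast h1.le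
  have h4 := Real.log_le_log (by positivity) h3
  rw [Real.log_pow] at h4
  have h5 : (Nat.clog 2 n : ℝ) ≤ (Nat.clog 2 n - 1 : ℕ) + 1 := by
    exact_mod_cast (by omega : Nat.clog 2 n ≤ Nat.clog 2 n - 1 + 1)
  have h6 : (Nat.clog 2 n - 1 : ℕ) * 0.69 ≤ ((Nat.clog 2 n - 1 : ℕ) : ℝ) * Real.log 2 := by
    gcongr; linarith
  unfold numScales
  linarith

theorem numRounds_le_polylog (hn : 2 ≤ n) (hε : 0 < ε ∧ ε < 1) :
    (numRounds n m ε : ℝ) ≤ 10 ^ 10 * polylog 1 n m ε ^ 7 := by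
  obtain ⟨hp, -, hl, hL, ht⟩ := bounds_by_polylog (m := m) hn hε
  refine (numRounds_le hn hε).trans ?_
  have hl0 : 0 ≤ Real.log n := Real.log_natCast_nonneg n
  have hL0 : 0 ≤ Real.log (max (m : ℝ) 2) :=
    (Real.log_nonneg one_le_two).trans (log_two_le_log_max m)
  have ht0 : 0 ≤ 1 / ε := one_div_nonneg.2 hε.1.le
  set p := polylog 1 n m ε
  calc 80 * 20 ^ 4 * roundBound n m ε =
        80 * 20 ^ 4 * (Real.log (max (m : ℝ) 2) ^ 2 * Real.log n * (1 / ε) ^ 4) := by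
        unfold roundBound; rw [one_div, inv_pow, div_eq_mul_inv]
    _ ≤ 80 * 20 ^ 4 * ((2 * p) ^ 2 * (2 * p) * (3 * p) ^ 4) := by gcongr
    _ = 80 * 20 ^ 4 * 648 * p ^ 7 := by ring
    _ ≤ 10 ^ 10 * p ^ 7 := by gcongr; norm_num

theorem numScales_le_polylog (hn : 2 ≤ n) (hε : 0 < ε ∧ ε < 1) :
    (numScales n : ℝ) + 1 ≤ 10 * polylog 1 n m ε := by
  linarith [numScales_le hn, (bounds_by_polylog (m := m) hn hε).2.2.1]

/-- The number of samples for each point, for failure probability `n ^ (-c)`. -/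
noncomputable def numSamples (c n m : ℕ) (ε : ℝ) : ℕ :=
  ⌈(n : ℝ) / (ε / 20) ^ 2 * (2 * ((numScales n : ℝ) + 1) + numRounds n m ε +
    (c + 2) * Real.log ((n : ℝ) + 1))⌉₊

theorem numSamples_pos (c : ℕ) (hn : 2 ≤ n) (hε : 0 < ε) : 0 < numSamples c n m ε := by
  have : 0 ≤ Real.log ((n : ℝ) + 1) := Real.log_nonneg (by linarith [n.cast_nonneg (α := ℝ)])
  have : (0 : ℝ) < n := by positivity
  exact Nat.ceil_pos.2 (by positivity)

theorem mul_exp_neg_le_one (x : ℝ) : x * Real.exp (-x) ≤ 1 := by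
  rw [Real.exp_neg, ← div_eq_mul_inv, div_le_one (Real.exp_pos x)]
  linarith [Real.add_one_le_exp x]

theorem failure_le (c : ℕ) (hn : 2 ≤ n) (hε : 0 < ε) :
    (numRounds n m ε : ℝ) * ((numScales n + 1 : ℕ) * ((n : ℝ) + 1) *
      (2 * Real.exp (-((ε / 20) ^ 2 * (numSamples c n m ε / n))))) ≤ 1 / (n : ℝ) ^ c := by
  have hn0 : (0 : ℝ) < n := by positivity
  have ha : 0 < (ε / 20) ^ 2 := by positivity
  have hs : (n : ℝ) / (ε / 20) ^ 2 * (2 * ((numScales n : ℝ) + 1) + numRounds n m ε +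
    (c + 2) * Real.log ((n : ℝ) + 1)) ≤ numSamples c n m ε := Nat.le_ceil _
  set s := (numSamples c n m ε : ℝ)
  set R := (numRounds n m ε : ℝ)
  have hR0 : 0 ≤ R := Nat.cast_nonneg _
  push_cast
  set g := (numScales n : ℝ) + 1
  have hg0 : 0 ≤ g := by positivity
  have h1 : 2 * g + R + (c + 2) * Real.log ((n : ℝ) + 1) ≤ (ε / 20) ^ 2 * (s / n) := by
    rw [div_mul_eq_mul_div, div_le_iff₀ ha] at hs
    rw [← mul_div_assoc, le_div_iff₀ hn0]
    linarith
  have h2 : Real.exp (-((ε / 20) ^ 2 * (s / n))) ≤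
      Real.exp (-(2 * g)) * Real.exp (-R) * (1 / ((n : ℝ) + 1) ^ (c + 2)) := by
    have e : 1 / ((n : ℝ) + 1) ^ (c + 2) = Real.exp (-((c + 2) * Real.log ((n : ℝ) + 1))) := by
      rw [Real.exp_neg, one_div, ← Real.exp_log (show (0 : ℝ) < ((n : ℝ) + 1) ^ (c + 2) by
        positivity), Real.log_pow]
      push_cast
      rfl
    rw [e, ← Real.exp_add, ← Real.exp_add]
    exact Real.exp_le_exp.2 (by linarith)
  calc _ ≤ R * (g * ((n : ℝ) + 1) *
        (2 * (Real.exp (-(2 * g)) * Real.exp (-R) * (1 / ((n : ℝ) + 1) ^ (c + 2))))) := by gcongr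
    -- Each summand in `numSamples` cancels one factor of the union bound: guesses and rounds
    -- through x exp(-x) ≤ 1, the n + 1 estimates through the power of n + 1.
    _ = (2 * g * Real.exp (-(2 * g))) * (R * Real.exp (-R)) * (1 / ((n : ℝ) + 1) ^ (c + 1)) := by
        rw [pow_succ _ (c + 1)]
        field_simp
    _ ≤ 1 * 1 * (1 / ((n : ℝ) + 1) ^ (c + 1)) := by
        gcongr
        · exact mul_exp_neg_le_one _
        · exact mul_exp_neg_le_one _
    _ ≤ 1 / (n : ℝ) ^ c := by
        rw [one_mul, one_mul]
        refine one_div_le_one_div_of_le (by positivity) ?_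
        calc (n : ℝ) ^ c ≤ ((n : ℝ) + 1) ^ c := by gcongr; linarith
          _ ≤ ((n : ℝ) + 1) ^ (c + 1) := pow_le_pow_right₀ (by linarith) (Nat.le_succ c)

theorem numSamples_le (c : ℕ) (hn : 2 ≤ n) (hε : 0 < ε ∧ ε < 1) :
    (numSamples c n m ε : ℝ) ≤ n * ((10 ^ 15 + 10 ^ 8 * c) * polylog 1 n m ε ^ 9) := by
  obtain ⟨hp, hp1, hl, -, ht⟩ := bounds_by_polylog (m := m) hn hε
  have hR := numRounds_le_polylog (m := m) hn hε
  have hg := numScales_le_polylog (m := m) hn hε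
  have hln := log_succ_le hn
  have hn0 : (1 : ℝ) ≤ n := by exact_mod_cast (by omega : 1 ≤ n)
  have hln0 : 0 ≤ Real.log ((n : ℝ) + 1) := Real.log_nonneg (by linarith)
  have hε0 := hε.1
  have ht0 : 0 ≤ 1 / ε := one_div_nonneg.2 hε0.le
  refine (Nat.ceil_lt_add_one (by positivity)).le.trans ?_
  set p := polylog 1 n m ε
  have hp7 : p ≤ 729 * p ^ 7 := by
    have := one_le_pow₀ (n := 6) hp1
    have := mul_le_mul_of_nonneg_left this hp.le
    linarith
  have hp9 : 1 ≤ 19683 * p ^ 9 := by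
    have := one_le_pow₀ (n := 9) hp1
    linarith
  have e1 : 1 / (ε / 20) ^ 2 ≤ 3600 * p ^ 2 := by
    calc 1 / (ε / 20) ^ 2 = 400 * (1 / ε) ^ 2 := by field_simp; norm_num
      _ ≤ 400 * (3 * p) ^ 2 := by gcongr
      _ = _ := by ring
  have e2 : 2 * ((numScales n : ℝ) + 1) + numRounds n m ε + (c + 2) * Real.log ((n : ℝ) + 1) ≤
      (10 ^ 11 + 3000 * c) * p ^ 7 := by
    have : (c + 2) * Real.log ((n : ℝ) + 1) ≤ (c + 2) * (4 * (729 * p ^ 7)) := by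
      gcongr; linarith
    have : 0 ≤ (c : ℝ) * p ^ 7 := by positivity
    linarith
  calc _ = n * ((1 / (ε / 20) ^ 2) * (2 * ((numScales n : ℝ) + 1) + numRounds n m ε +
        (c + 2) * Real.log ((n : ℝ) + 1))) + 1 := by ring
    _ ≤ n * ((3600 * p ^ 2) * ((10 ^ 11 + 3000 * c) * p ^ 7)) + n * (19683 * p ^ 9) := by
        gcongr
        nlinarith
    _ = n * ((3600 * (10 ^ 11 + 3000 * c) + 19683) * p ^ 9) := by ring
    _ ≤ _ := by
        gcongr n * (?_ * p ^ 9)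
        have := c.cast_nonneg (α := ℝ)
        linarith

end Parameters

/-! ### Assembly of both algorithms. -/

section Main

variable {n m : ℕ} {A : Matrix (Fin m) (Fin n) ℝ} {ε : ℝ} {f : Finset (Fin n) → ℝ} {Q : Type}

open Classical in
/-- The algorithm, with a given way to obtain estimates of values and gradients. -/
noncomputable def algorithm (A : Matrix (Fin m) (Fin n) ℝ) (ε : ℝ)
    (impl : (Fin (numScales n + 1) → cube n) →
      ((Fin (numScales n + 1) → ℝ × (Fin n → ℝ)) → OracleAlg Q (Fin n → ℝ)) →
      OracleAlg Q (Fin n → ℝ)) : OracleAlg Q (Fin n → ℝ) :=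
  -- For n ≤ 1 the factor log n is 0, so no round is allowed; the all-ones vector is feasible and
  -- optimal.
  if n ≤ 1 ∨ m = 0 then .output 1
  else if hε : 0 < ε ∧ ε < 1 then
    (solve (stepParams m ε hε) A (numScales n) (numSteps n m ε) (numPhases m ε)).compile impl
  -- For ε ≥ 1 the required ratio is negative, so the origin is good enough.
  else .output 0

theorem isApproxSolution_one (hf : IsMonotoneSubmodular f) (hA : ∀ i j, 0 ≤ A i j ∧ A i j ≤ 1)
    (h : n ≤ 1 ∨ m = 0) {α : ℝ} (hα : α ≤ 1) : IsApproxSolution A f α 1 := by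
  have h1 : (1 : Fin n → ℝ) ∈ cube n := fun i => by simp
  refine isApproxSolution_of_gain hf hα hα ⟨h1, fun i => ?_⟩ fun z hz => ?_
  · rcases h with h | rfl
    · simp only [Matrix.mulVec, dotProduct, Pi.one_apply, mul_one]
      refine (Finset.sum_le_sum (g := fun _ => 1) fun j _ => (hA i j).2).trans ?_
      simpa using h
    · exact i.elim0
  · rw [one_mul]
    exact sub_le_sub_right (multilinearExt_mono hf.mono hz.1 h1 fun i => (hz.1 i).2) _

theorem isApproxSolution_zero (hf : IsMonotoneSubmodular f) {α : ℝ} (hα : α ≤ 0) :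
    IsApproxSolution A f α 0 :=
  ⟨⟨zero_mem_cube, fun i => by simp⟩, fun _ hz =>
    (mul_nonpos_of_nonpos_of_nonneg hα (multilinearExt_nonneg hf.nonneg hz.1)).trans
      (multilinearExt_nonneg hf.nonneg zero_mem_cube)⟩

theorem safe_solve_stepParams (hf : IsMonotoneSubmodular f)
    (hA : ∀ i j, 0 ≤ A i j ∧ A i j ≤ 1) (hn : 2 ≤ n) (hm : m ≠ 0) (hε : 0 < ε ∧ ε < 1) :
    ∃ v, 0 ≤ v ∧ (∀ j, multilinearExt (marginal f j) 0 ≤ v) ∧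
      (solve (stepParams m ε hε) A (numScales n) (numSteps n m ε) (numPhases m ε)).Safe
        (GoodAnswer f (ε / 20) v) (IsApproxSolution A f (1 - 1 / Real.exp 1 - ε)) := by
  have : Nonempty (Fin n) := ⟨⟨0, by omega⟩⟩
  obtain ⟨j, hj⟩ := Finite.exists_max fun j => multilinearExt (marginal f j) 0
  have hv0 := hf.grad_nonneg j zero_mem_cube
  refine ⟨_, hv0, hj, ?_⟩
  refine (safe_solve hf hA (Nat.pos_of_ne_zero hm) (by omega) hv0 hj ⟨j, rfl⟩
    (Nat.le_pow_clog (by norm_num) n) (numSteps_spec hε) (numPhases_spec hε)).imp fun x hx => ?_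
  have he : 0 < 1 / Real.exp 1 := by positivity
  refine isApproxSolution_of_gain hf ?_ (by linarith [hε.1]) hx.1 hx.2
  have : (stepParams m ε hε).a = ε / 20 := rfl
  rw [this]
  linarith [hε.1]

/-- In the trivial cases the algorithm stops at once. -/
theorem algorithm_cases (hA : ∀ i j, 0 ≤ A i j ∧ A i j ≤ 1) (hε : 0 < ε)
    (impl : (Fin (numScales n + 1) → cube n) →
      ((Fin (numScales n + 1) → ℝ × (Fin n → ℝ)) → OracleAlg Q (Fin n → ℝ)) →
      OracleAlg Q (Fin n → ℝ)) :
    (∃ x, algorithm A ε impl = .output x ∧ ∀ f, IsMonotoneSubmodular f →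
        IsApproxSolution A f (1 - 1 / Real.exp 1 - ε) x) ∨
      2 ≤ n ∧ m ≠ 0 ∧ ∃ hε' : 0 < ε ∧ ε < 1, algorithm A ε impl =
        (solve (stepParams m ε hε') A (numScales n) (numSteps n m ε) (numPhases m ε)).compile
          impl := by
  have he : 0 < 1 / Real.exp 1 := by positivity
  unfold algorithm
  by_cases h : n ≤ 1 ∨ m = 0
  · rw [if_pos h]
    exact Or.inl ⟨1, rfl, fun f hf => isApproxSolution_one hf hA h (by linarith)⟩
  rw [if_neg h]
  by_cases h' : 0 < ε ∧ ε < 1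
  · rw [dif_pos h']
    exact Or.inr ⟨by omega, by omega, h', rfl⟩
  · rw [dif_neg h']
    have : 1 ≤ ε := not_lt.1 fun h => h' ⟨hε, h⟩
    exact Or.inl ⟨0, rfl, fun f hf => isApproxSolution_zero hf (by linarith)⟩

theorem isDeterministic_exactImpl {G : ℕ} {X : Type} (p : Fin G → cube n)
    (k : (Fin G → ℝ × (Fin n → ℝ)) → OracleAlg (MLQuery n) X)
    (hk : ∀ r, (k r).IsDeterministic) : (exactImpl p k).IsDeterministic :=
  fun _ => hk _

theorem rounds_exactImpl_le {G : ℕ} {X : Type} (O : MLQuery n → ℝ) (p : Fin G → cube n)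
    (k : (Fin G → ℝ × (Fin n → ℝ)) → OracleAlg (MLQuery n) X) (b : ℕ∞)
    (hk : ∀ r, (k r).rounds O ≤ b) : (exactImpl p k).rounds O ≤ 1 + b :=
  add_le_add le_rfl (hk _)

theorem queries_exactImpl_le {G : ℕ} {X : Type} (O : MLQuery n → ℝ) (p : Fin G → cube n)
    (k : (Fin G → ℝ × (Fin n → ℝ)) → OracleAlg (MLQuery n) X) (b : ℕ∞)
    (hk : ∀ r, (k r).queries O ≤ b) :
    (exactImpl p k).queries O ≤ (G * (n + 1) : ℕ) + b :=
  add_le_add (Nat.cast_le.2 (card_exactBatch_le p)) (hk _)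

theorem rounds_sampleImpl_le {G s : ℕ} {X : Type} (O : Finset (Fin n) → ℝ)
    (p : Fin G → cube n) (k : (Fin G → ℝ × (Fin n → ℝ)) → OracleAlg (Finset (Fin n)) X)
    (b : ℕ∞) (hk : ∀ r, (k r).rounds O ≤ b) : (sampleImpl s p k).rounds O ≤ 1 + b :=
  iSup_le fun _ => add_le_add le_rfl (hk _)

theorem queries_sampleImpl_le {G s : ℕ} {X : Type} (O : Finset (Fin n) → ℝ)
    (p : Fin G → cube n) (k : (Fin G → ℝ × (Fin n → ℝ)) → OracleAlg (Finset (Fin n)) X)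
    (b : ℕ∞) (hk : ∀ r, (k r).queries O ≤ b) :
    (sampleImpl s p k).queries O ≤ (G * s * (n * 2 + 1) : ℕ) + b :=
  iSup_le fun ω => add_le_add (Nat.cast_le.2 (card_sampleBatch_le ω)) (hk _)

theorem exact_queries_le (hn : 2 ≤ n) (hε : 0 < ε ∧ ε < 1) :
    numRounds n m ε * ((numScales n + 1) * (n + 1)) ≤
      ⌊(2 * 10 ^ 11 : ℝ) * (n * polylog 8 n m ε)⌋₊ := by
  refine Nat.le_floor ?_
  have hp := (bounds_by_polylog (m := m) hn hε).1
  have hn1 : (1 : ℝ) ≤ n := by exact_mod_cast (by omega : 1 ≤ n)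
  push_cast
  rw [polylog_eq 8]
  calc _ ≤ (10 ^ 10 * polylog 1 n m ε ^ 7) * ((10 * polylog 1 n m ε) * ((n : ℝ) + n)) := by
        gcongr
        · exact numRounds_le_polylog hn hε
        · exact numScales_le_polylog hn hε
    _ = _ := by ring

theorem sample_queries_le (c : ℕ) (hn : 2 ≤ n) (hε : 0 < ε ∧ ε < 1) :
    numRounds n m ε * ((numScales n + 1) * numSamples c n m ε * (n * 2 + 1)) ≤
      ⌊(3 * 10 ^ 11 * (10 ^ 15 + 10 ^ 8 * c) : ℝ) * ((n : ℝ) ^ 2 * polylog 17 n m ε)⌋₊ := by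
  refine Nat.le_floor ?_
  have hp := (bounds_by_polylog (m := m) hn hε).1
  have hn1 : (1 : ℝ) ≤ n := by exact_mod_cast (by omega : 1 ≤ n)
  push_cast
  rw [polylog_eq 17]
  -- Rounds, guesses and samples contribute the exponents 7 + 1 + 9 = 17. One factor n comes from
  -- the samples, the other from the 2n + 1 sets per sample.
  calc _ ≤ (10 ^ 10 * polylog 1 n m ε ^ 7) * ((10 * polylog 1 n m ε) *
        (n * ((10 ^ 15 + 10 ^ 8 * c) * polylog 1 n m ε ^ 9)) * ((n : ℝ) * 2 + n)) := by
        gcongr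
        · exact numRounds_le_polylog hn hε
        · exact numScales_le_polylog hn hε
        · exact numSamples_le c hn hε
    _ = _ := by ring

end Main

end PackingML

theorem theorem1 :
    -- deterministic algorithm with oracles for `F` and its gradient
    (∃ (alg : ∀ n m : ℕ, Matrix (Fin m) (Fin n) ℝ → ℝ →
          PackingML.OracleAlg (PackingML.MLQuery n) (Fin n → ℝ)) (C K : ℝ) (k : ℕ),
        ∀ (n m : ℕ) (A : Matrix (Fin m) (Fin n) ℝ) (ε : ℝ),
          (∀ i j, 0 ≤ A i j ∧ A i j ≤ 1) → 0 < ε →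
          (alg n m A ε).IsDeterministic ∧
          ∀ f : Finset (Fin n) → ℝ, PackingML.IsMonotoneSubmodular f →
            (∃ x, (alg n m A ε).run (PackingML.mlOracle f) = PMF.pure x ∧
              PackingML.IsApproxSolution A f (1 - 1 / Real.exp 1 - ε) x) ∧
            (alg n m A ε).rounds (PackingML.mlOracle f) ≤
              (⌊C * PackingML.roundBound n m ε⌋₊ : ℕ∞) ∧
            (alg n m A ε).queries (PackingML.mlOracle f) ≤
              (⌊K * (n * PackingML.polylog k n m ε)⌋₊ : ℕ∞)) ∧
    -- randomized algorithm with a value oracle for `f`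
    (∃ C : ℝ, ∀ c : ℕ,
      ∃ (alg : ∀ n m : ℕ, Matrix (Fin m) (Fin n) ℝ → ℝ →
          PackingML.OracleAlg (Finset (Fin n)) (Fin n → ℝ)) (K : ℝ) (k : ℕ),
        ∀ (n m : ℕ) (A : Matrix (Fin m) (Fin n) ℝ) (ε : ℝ),
          (∀ i j, 0 ≤ A i j ∧ A i j ≤ 1) → 0 < ε →
          ∀ f : Finset (Fin n) → ℝ, PackingML.IsMonotoneSubmodular f →
            1 - 1 / (n : ℝ) ^ c ≤
              (((alg n m A ε).run f).toOuterMeasure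
                {x | PackingML.IsApproxSolution A f (1 - 1 / Real.exp 1 - ε) x}).toReal ∧
            (alg n m A ε).rounds f ≤ (⌊C * PackingML.roundBound n m ε⌋₊ : ℕ∞) ∧
            (alg n m A ε).queries f ≤
              (⌊K * ((n : ℝ) ^ 2 * PackingML.polylog k n m ε)⌋₊ : ℕ∞)) := by
  constructor
  · refine ⟨fun n m A ε => PackingML.algorithm A ε PackingML.exactImpl, 80 * 20 ^ 4, 2 * 10 ^ 11,
      8, fun n m A ε hA hε => ?_⟩
    beta_reduce
    rcases PackingML.algorithm_cases hA hε PackingML.exactImpl with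
      ⟨x, hx, hgood⟩ | ⟨hn, hm, hε', h⟩
    · rw [hx]
      exact ⟨trivial, fun f hf => ⟨⟨x, rfl, hgood f hf⟩, zero_le, zero_le⟩⟩
    · rw [h]
      refine ⟨PackingML.Dialogue.isDeterministic_compile PackingML.isDeterministic_exactImpl _,
        fun f hf => ⟨?_, ?_, ?_⟩⟩
      -- The scale `v` depends on `f` and enters only the analysis; the algorithm is fixed without
      -- it.
      · obtain ⟨v, hv0, -, hsafe⟩ := PackingML.safe_solve_stepParams hf hA hn hm hε'
        exact PackingML.Dialogue.run_compile_eq_pure (fun p => ⟨_,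
          PackingML.goodAnswer_exactAnswer hf (by positivity) hv0 p,
          PackingML.run_exactImpl _ p⟩) hsafe
      · exact (PackingML.Dialogue.rounds_compile_le (PackingML.rounds_exactImpl_le _)
          (PackingML.depthLE_solve _ _ _)).trans
          (Nat.cast_le.2 (Nat.le_floor (PackingML.numRounds_le hn hε')))
      · exact (PackingML.Dialogue.queries_compile_le (PackingML.queries_exactImpl_le _)
          (PackingML.depthLE_solve _ _ _)).trans
          (Nat.cast_le.2 (PackingML.exact_queries_le hn hε'))
  · refine ⟨80 * 20 ^ 4, fun c => ⟨fun n m A ε => PackingML.algorithm A ε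
      (PackingML.sampleImpl (PackingML.numSamples c n m ε)),
      3 * 10 ^ 11 * (10 ^ 15 + 10 ^ 8 * c), 17, fun n m A ε hA hε f hf => ?_⟩⟩
    beta_reduce
    rcases PackingML.algorithm_cases hA hε
      (PackingML.sampleImpl (PackingML.numSamples c n m ε)) with
      ⟨x, hx, hgood⟩ | ⟨hn, hm, hε', h⟩
    · rw [hx]
      refine ⟨?_, zero_le, zero_le⟩
      simp only [PackingML.OracleAlg.run, PMF.toOuterMeasure_pure_apply, Set.mem_ofPred_eq,
        hgood f hf, if_true, ENNReal.toReal_one]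
      exact sub_le_self _ (by positivity)
    · rw [h]
      refine ⟨?_, ?_, ?_⟩
      · obtain ⟨v, hv0, hv, hsafe⟩ := PackingML.safe_solve_stepParams hf hA hn hm hε'
        refine (sub_le_sub_left (PackingML.failure_le (m := m) c hn hε) 1).trans ?_
        exact PackingML.Dialogue.success_compile (by positivity)
          (PackingML.success_sampleImpl (PackingML.numSamples_pos c hn hε) (by omega) hf
            (by positivity) (by linarith [hε'.2]) hv hv0 _)
          (PackingML.depthLE_solve _ _ _) hsafe
      · exact (PackingML.Dialogue.rounds_compile_le (PackingML.rounds_sampleImpl_le _)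
          (PackingML.depthLE_solve _ _ _)).trans
          (Nat.cast_le.2 (Nat.le_floor (PackingML.numRounds_le hn hε')))
      · exact (PackingML.Dialogue.queries_compile_le (PackingML.queries_sampleImpl_le _)
          (PackingML.depthLE_solve _ _ _)).trans
          (Nat.cast_le.2 (PackingML.sample_queries_le c hn hε'))
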